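/- Let $d\ge 1$, $n\ge 0$, let $u=(u_1,\dots,u_{d+1})\in\mathbb C^{d+1}$ with $u_{d+1}\neq 0$, and put $V_u(x)=\sum_{K=1}^{d+1}u_K\frac{x^K}{K}$. For $\vartheta=-\arg(u_{d+1})/(d+1)$ let $\mathcal S_k$ be the open sector $\left|\arg x-\vartheta-\frac{k\pi}{d+1}\right|<\frac{\pi}{2(d+1)}$, so that $\Re V_u\to+\infty$ in the even sectors. For $k=1,\dots,d$ let $\Gamma_k$ be a contour, parametrized by a Lipschitz map of $\mathbb R$ with $\Gamma_k(s)/|s|\to c_k^{-}$ as $s\to-\infty$ and $\Gamma_k(s)/|s|\to c_k^{+}$ as $s\to+\infty$, where $c_k^-\in\mathcal S_{2k-2}$ and $c_k^+\in\mathcal S_{2k}$. Let $\varkappa_1,\dots,\varkappa_d\in\mathbb C$, $\int_{\varkappa\Gamma}=\sum_k\varkappa_k\int_{\Gamma_k}$, and let $\mathcal L(q)=\int_{\varkappa\Gamma}e^{-V_u(x)}q(x)\,dx$ for polynomials $q$. Assume that the monic orthogonal polynomials $p_0,p_1,\dots$ of $\mathcal L$ exist: $\deg p_j=j$ and $\mathcal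 L(p_ip_j)=h_j\delta_{ij}$ with $h_j\ne0$. For $t=(t_1,\dots,t_{d+1})\in\mathbb C^{d+1}$ put $\xi_t(z)=\sum_{J=1}^{d+1}t_J\frac{z^J}{J}$ and $$\mathcal Z_n(t)=\int_{\varkappa\Gamma}dx_1\cdots\int_{\varkappa\Gamma}dx_n\prod_{i<j}(x_i-x_j)^2\,e^{-\sum_j V_{u+t}(x_j)}.$$ For an entire function $f$ let $f_{\ge n}$ be the part of its Taylor series at $0$ with exponents $\ge n$. Let $\mathcal H_n=\mathrm{span}\{z^j\}_{j<n}$, $\mathcal H_+=\mathrm{span}\{z^j\}_{j\ge n}$, and $w_0=\mathrm{span}\{p_j\}_{j\ge n}$. For a subspace $W$ of $\mathbb C[z]$, an admissible frame of $W$ is a basis $(w_j)_{j\ge0}$ of $W$ with $w_j$ monic of degree $n+j$. The KP tau function of $W$ (with respect to the splitting $\mathcal H_n+\mathcal H_+$) is $$\tau_W(t)=\lim_{N\to\infty}\det\Big([z^{n+i}]\,e^{\xi_t(z)}w_j(z)\Big)_{0\le i,j<N},$$ that is, the determinant of the projection to $\mathcal H_+$ of the frame of $W$ moved by the group element $\exp(\sum_J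 t_Jz^J/J)$ acting by multiplication, the infinite determinant being the limit of its finite truncations. Then: 1. $w_0$ belongs to the Grassmannian of subspaces commensurable with $\mathcal H_+$ (the projection $w_0\to\mathcal H_+$ is Fredholm, and in fact bijective), and $(p_{n+j})_{j\ge0}$ is an admissible frame of $w_0$. The integral $\mathcal Z_n(0)$ converges absolutely and is nonzero. 2. Let $t$ be such that $\Re\big((u_{d+1}+t_{d+1})c^{d+1}\big)>0$ for every $c\in\{c_k^\pm\}$. Then $\mathcal Z_n(t)$ converges absolutely. Let $\mathcal H_{+,t}$ be the space of entire functions $f$ that vanish to order at least $n$ at $0$ and for which $\int_{\Gamma_k}|f(x)\,x^m e^{-V_{u+t}(x)}|\,|dx|<\infty$ for all $k$ and all $m\ge 0$. Then the formula $$\widehat Kf(z)=\int_{\varkappa\Gamma}dw\,e^{-V_u(w)}K(z,w)f(w),\qquad K(z,w)=\sum_{j=0}^{n-1}\frac1{h_j}\big(e^{\xi_t(z)}p_j(z)\big)_{\ge n}\,p_j(w)\,e^{-\xi_t(w)},$$ defines a linear operator $\widehat K:\mathcal H_{+,t}\to\mathcal H_{+,t}$ of rank at most $n$, and its Fredholm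 determinant (the determinant of $1-\widehat K$ on the finite-dimensional range of $\widehat K$) is $$\det(1-\widehat K)=\frac{\mathcal Z_n(t)}{\mathcal Z_n(0)}.$$ 3. Suppose moreover that $|t_{d+1}|\,|c|^{d+1}<\Re\big(u_{d+1}c^{d+1}\big)$ for every $c\in\{c_k^\pm\}$ (that is, $|t_{d+1}|<|u_{d+1}|$ if the contours go to infinity along the bisectors of the sectors). Then the limit defining $\tau_{w_0}(t)$ exists in every admissible frame of $w_0$, in particular in the frame $(p_{n+j})$, and $$\tau_{w_0}(t)=\frac{\mathcal Z_n(t)}{\mathcal Z_n(0)}=\det(1-\widehat K).$$ Furthermore the monomials $z^{n+k}$, $k\ge 0$, lie in $\mathcal H_{+,t}$, and for all $i,k\ge0$ the coefficient of $z^{n+i}$ in $\widehat K z^{n+k}$ is the corresponding entry of the matrix $-B\,W_{n+}W_+^{-1}C^{-1}$ (given by a convergent series). Here, relative to the splitting $\mathcal H_n+\mathcal H_+$, the matrix $\begin{pmatrix}W_n&W_{n+}\\0&W_+\end{pmatrix}$ has the coefficients of the $p_j$ as its columns, and $\begin{pmatrix}A&0\\B&C\end{pmatrix}$ is the matrix of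 multiplication by $e^{\xi_t(z)}$ in the basis $1,z,z^2,\dots$. -/

import Mathlib

open Filter Topology MeasureTheory Polynomial

noncomputable section

namespace KPTau

/-! ### Potential, contours, moment functional, partition function -/

/-- `∑_{K=1}^{d+1} a_K x^K / K`.  With `a = u` this is the potential `V(x)`; with `a = t` it is the
exponent `∑_J t_J z^J / J` of the commuting flows, for `t = (t_1, …, t_{d+1}, 0, 0, …)`. -/
def potential (d : ℕ) (a : ℕ → ℂ) (x : ℂ) : ℂ :=
  ∑ K ∈ Finset.Icc 1 (d + 1), a K * x ^ K / (K : ℂ)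

/-- The open sector `S_k` of aperture `π/(d+1)` about the direction `ϑ + kπ/(d+1)`, where
`ϑ = -arg(u_{d+1})/(d+1)`, so that `Re V → +∞` in the even sectors. -/
def sector (d : ℕ) (u : ℕ → ℂ) (k : ℕ) : Set ℂ :=
  {x | ∃ r θ : ℝ, 0 < r ∧
    -Complex.arg (u (d + 1)) / (d + 1) + (2 * k - 1) * Real.pi / (2 * (d + 1)) < θ ∧
    θ < -Complex.arg (u (d + 1)) / (d + 1) + (2 * k + 1) * Real.pi / (2 * (d + 1)) ∧
    x = r * Complex.exp (θ * Complex.I)}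

/-- Contours `Γ_1, …, Γ_d` (here indexed from `0`): `Γ_k` is a rectifiable curve, parametrized by a
Lipschitz map of `ℝ`, which comes from infinity in the sector `S_{2k-2}`, with asymptotic direction
`cIn k`, and returns to infinity in the sector `S_{2k}`, with asymptotic direction `cOut k`. -/
structure IsContourSystem (d : ℕ) (u : ℕ → ℂ) (Γ : Fin d → ℝ → ℂ) (cIn cOut : Fin d → ℂ) :
    Prop where
  lipschitz : ∀ k, ∃ C, LipschitzWith C (Γ k)
  cIn_mem : ∀ k : Fin d, cIn k ∈ sector d u (2 * k)
  cOut_mem : ∀ k : Fin d, cOut k ∈ sector d u (2 * k + 2)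
  tendsto_in : ∀ k, Tendsto (fun s : ℝ => Γ k s / ((|s| : ℝ) : ℂ)) atBot (𝓝 (cIn k))
  tendsto_out : ∀ k, Tendsto (fun s : ℝ => Γ k s / ((|s| : ℝ) : ℂ)) atTop (𝓝 (cOut k))

/-- `∫_{ϰΓ} f(x) dx = ∑_k ϰ_k ∫_{Γ_k} f(x) dx`. -/
def contourIntegral {d : ℕ} (ϰ : Fin d → ℂ) (Γ : Fin d → ℝ → ℂ) (f : ℂ → ℂ) : ℂ :=
  ∑ k, ϰ k * ∫ s : ℝ, f (Γ k s) * deriv (Γ k) s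

/-- The moment functional `L(q) = ∫_{ϰΓ} e^{-V(x)} q(x) dx`. -/
def momentFunctional {d : ℕ} (u : ℕ → ℂ) (ϰ : Fin d → ℂ) (Γ : Fin d → ℝ → ℂ) (q : ℂ[X]) : ℂ :=
  contourIntegral ϰ Γ (fun x => Complex.exp (-potential d u x) * q.eval x)

/-- `p_0, p_1, …` are the monic orthogonal polynomials of the moment functional and `h_0, h_1, …`
their (nonzero) normalization constants. -/
structure IsMonicOrthogonal {d : ℕ} (u : ℕ → ℂ) (ϰ : Fin d → ℂ) (Γ : Fin d → ℝ → ℂ)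
    (p : ℕ → ℂ[X]) (h : ℕ → ℂ) : Prop where
  monic : ∀ j, (p j).Monic
  natDegree_eq : ∀ j, (p j).natDegree = j
  h_ne_zero : ∀ j, h j ≠ 0
  orthogonal : ∀ i j, momentFunctional u ϰ Γ (p i * p j) = if i = j then h i else 0

/-- The integrand `Δ(x)² e^{-∑ V(x_j)} dx_1 ⋯ dx_n` pulled back to the parameters
`s_1, …, s_n`, with `x_j` running over the contour `Γ_{σ j}`. -/
def partitionIntegrand {d : ℕ} (n : ℕ) (v : ℕ → ℂ) (Γ : Fin d → ℝ → ℂ) (σ : Fin n → Fin d)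
    (s : Fin n → ℝ) : ℂ :=
  (∏ i : Fin n, ∏ j ∈ Finset.Ioi i, (Γ (σ i) (s i) - Γ (σ j) (s j))) ^ 2 *
    Complex.exp (-∑ j, potential d v (Γ (σ j) (s j))) * ∏ j, deriv (Γ (σ j)) (s j)

/-- The partition function
`Z_n = ∫_{ϰΓ} dx_1 ⋯ ∫_{ϰΓ} dx_n Δ(x)² e^{-∑ V(x_j)}` for the potential with coefficients `v`. -/
def partitionFunction {d : ℕ} (n : ℕ) (v : ℕ → ℂ) (ϰ : Fin d → ℂ) (Γ : Fin d → ℝ → ℂ) : ℂ :=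
  ∑ σ : Fin n → Fin d, (∏ j, ϰ (σ j)) * ∫ s : Fin n → ℝ, partitionIntegrand n v Γ σ s

/-! ### Grassmannian and tau function -/

/-- The coefficient of `z^k` in the Taylor series of `f` at the origin. -/
def taylorCoeff (f : ℂ → ℂ) (k : ℕ) : ℂ := iteratedDeriv k f 0 / (k.factorial : ℂ)

/-- The part `f_{≥ n}` of the Taylor series of an entire function `f`. -/
def tailPart (n : ℕ) (f : ℂ → ℂ) (z : ℂ) : ℂ :=
  f z - ∑ j ∈ Finset.range n, taylorCoeff f j * z ^ j

/-- `H_+ = span {z^j}_{j ≥ n}` (before completion). -/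
def polyPlus (n : ℕ) : Submodule ℂ ℂ[X] where
  carrier := {f | ∀ j < n, f.coeff j = 0}
  add_mem' hf hg j hj := by simp [hf j hj, hg j hj]
  zero_mem' := by simp
  smul_mem' c f hf j hj := by simp [hf j hj]

/-- The projection `span {z^j}_{j ≥ 0} → H_+` along `H_n = span {z^j}_{j < n}`. -/
def projPlus (n : ℕ) : ℂ[X] →ₗ[ℂ] polyPlus n where
  toFun f := ⟨f - ∑ j ∈ Finset.range n, monomial j (f.coeff j), by
    intro j hj
    simp [Polynomial.coeff_monomial, hj]⟩
  map_add' f g := by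
    ext1
    simp only [Polynomial.coeff_add, map_add, Finset.sum_add_distrib, Submodule.coe_add]
    ring
  map_smul' c f := by
    ext1
    simp [smul_sub, Finset.smul_sum, Polynomial.smul_monomial]

/-- The projection `W → H_+`. -/
def projOn (n : ℕ) (W : Submodule ℂ ℂ[X]) : W →ₗ[ℂ] polyPlus n := projPlus n ∘ₗ W.subtype

/-- `W` is commensurable with `H_+`: the projection `W → H_+` is Fredholm.  (The projection of `W`
to the `n`-dimensional complement `H_n` is automatically of finite rank.) -/
def InGrassmannian (n : ℕ) (W : Submodule ℂ ℂ[X]) : Prop :=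
  Module.Finite ℂ (LinearMap.ker (projOn n W)) ∧
    Module.Finite ℂ (polyPlus n ⧸ LinearMap.range (projOn n W))

/-- The subspace `w_0 = span {p_j}_{j ≥ n}`. -/
def initialSubspace (n : ℕ) (p : ℕ → ℂ[X]) : Submodule ℂ ℂ[X] :=
  Submodule.span ℂ (p '' {j | n ≤ j})

/-- An admissible frame of `W`: a basis `w_0, w_1, …` whose projections to `H_+` are related
to the standard basis `z^n, z^{n+1}, …` by an upper triangular matrix with unit diagonal. -/
structure IsAdmissibleFrame (n : ℕ) (W : Submodule ℂ ℂ[X]) (w : ℕ → ℂ[X]) : Prop where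
  linearIndependent : LinearIndependent ℂ w
  span_eq : Submodule.span ℂ (Set.range w) = W
  monic : ∀ j, (w j).Monic
  natDegree_eq : ∀ j, (w j).natDegree = n + j

/-- The multiplication action of the group element `γ(t) = exp (∑_J t_J z^J / J)`. -/
def flow (d : ℕ) (t : ℕ → ℂ) (f : ℂ → ℂ) (z : ℂ) : ℂ := Complex.exp (potential d t z) * f z

/-- The infinite determinant of `M`: the limit of the determinants of its `N × N` truncations. -/
def HasInfiniteDet (M : Matrix ℕ ℕ ℂ) (δ : ℂ) : Prop :=
  Tendsto (fun N : ℕ => (M.submatrix (fun i : Fin N => (i : ℕ)) (fun j : Fin N => (j : ℕ))).det)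
    atTop (𝓝 δ)

/-- The matrix of the projection to `H_+` of the frame `γ(t) w_0, γ(t) w_1, …`, in the
standard basis `z^n, z^{n+1}, …`: the `+`-block of the homogeneous coordinates of `γ(t) W`. -/
def flowedPlusBlock (d n : ℕ) (t : ℕ → ℂ) (w : ℕ → ℂ[X]) : Matrix ℕ ℕ ℂ :=
  Matrix.of fun i j => taylorCoeff (flow d t (fun z => (w j).eval z)) (n + i)

/-- `τ` is the value at `t` of the KP tau function of `W`, the Plücker coordinate of `γ(t) W`
given by the determinant of the projection to `H_+`.  It is computed in an admissible frame of
`W`; it is part of the assertion that there are such frames and that all give the same value. -/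
def IsKPTau (d n : ℕ) (W : Submodule ℂ ℂ[X]) (t : ℕ → ℂ) (τ : ℂ) : Prop :=
  (∃ w, IsAdmissibleFrame n W w) ∧
    ∀ w, IsAdmissibleFrame n W w → HasInfiniteDet (flowedPlusBlock d n t w) τ

/-! ### The integral operator -/

/-- The completion of `H_+` on which the integral operator acts: entire functions `f` with a zero
of order at least `n` at the origin for which all integrals `∫_{Γ_k} f(x) x^m e^{-V(x)} dx`
converge absolutely, `V` being the potential with coefficients `v`. -/
def hPlus {d : ℕ} (n : ℕ) (v : ℕ → ℂ) (Γ : Fin d → ℝ → ℂ) : Submodule ℂ (ℂ → ℂ) where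
  carrier := {f | Differentiable ℂ f ∧ (∀ j < n, taylorCoeff f j = 0) ∧
    ∀ (k : Fin d) (m : ℕ), Integrable (fun s : ℝ =>
      f (Γ k s) * (Γ k s ^ m * Complex.exp (-potential d v (Γ k s)) * deriv (Γ k) s))}
  add_mem' := by
    rintro f g ⟨hf, hf0, hfi⟩ ⟨hg, hg0, hgi⟩
    refine ⟨hf.add hg, fun j hj => ?_, fun k m => ?_⟩
    · have h1 : iteratedDeriv j (f + g) 0 = iteratedDeriv j f 0 + iteratedDeriv j g 0 :=
        iteratedDeriv_add hf.contDiff.contDiffAt hg.contDiff.contDiffAt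
      have h2 := hf0 j hj
      have h3 := hg0 j hj
      unfold taylorCoeff at *
      rw [h1, add_div, h2, h3, add_zero]
    · refine ((hfi k m).add (hgi k m)).congr (Eventually.of_forall fun s => ?_)
      simp [add_mul]
  zero_mem' := by
    refine ⟨differentiable_const 0, fun j _ => ?_, fun k m => by simp⟩
    have h1 : iteratedDeriv j (0 : ℂ → ℂ) 0 = 0 := iteratedDeriv_const_zero
    simp [taylorCoeff, h1]
  smul_mem' := by
    rintro c f ⟨hf, hf0, hfi⟩
    refine ⟨hf.const_smul c, fun j hj => ?_, fun k m => ?_⟩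
    · have h1 : iteratedDeriv j (c • f) 0 = c • iteratedDeriv j f 0 :=
        iteratedDeriv_const_smul hf.contDiff.contDiffAt c
      have h2 := hf0 j hj
      unfold taylorCoeff at *
      rw [h1, smul_eq_mul, mul_div_assoc, h2, mul_zero]
    · simpa [mul_assoc] using (hfi k m).const_mul c

/-- The kernel
`K(z,w) = ∑_{j<n} h_j⁻¹ (e^{∑ t_K z^K/K} p_j(z))_{≥ n} p_j(w) e^{-∑ t_K w^K/K}`. -/
def kernel (d n : ℕ) (p : ℕ → ℂ[X]) (h : ℕ → ℂ) (t : ℕ → ℂ) (z w : ℂ) : ℂ :=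
  ∑ j ∈ Finset.range n, 1 / h j * tailPart n (flow d t (fun x => (p j).eval x)) z *
    ((p j).eval w * Complex.exp (-potential d t w))

/-- The Fredholm determinant `det (1 - K)` of an operator `K` of finite rank: `K` vanishes on the
quotient by its range, so this is the determinant of `1 - K` on the range of `K`. -/
def fredholmDet {E : Type*} [AddCommGroup E] [Module ℂ E] (K : E →ₗ[ℂ] E) : ℂ :=
  LinearMap.det (LinearMap.id - K.rangeRestrict ∘ₗ (LinearMap.range K).subtype)

/-! ### Block matrices -/

/-- The matrix whose `j`-th column consists of the expansion coefficients of `p_j`. -/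
def polyMatrix (p : ℕ → ℂ[X]) : Matrix ℕ ℕ ℂ := Matrix.of fun k j => (p j).coeff k

/-- The matrix of multiplication by `γ(t)` in the basis `1, z, z², …`. -/
def flowMatrix (d : ℕ) (t : ℕ → ℂ) : Matrix ℕ ℕ ℂ :=
  Matrix.of fun i j => taylorCoeff (flow d t (fun z => z ^ j)) i

/-- The lower right block of an infinite matrix (rows and columns with index at least `n`). -/
def plusBlock (n : ℕ) (M : Matrix ℕ ℕ ℂ) : Matrix ℕ ℕ ℂ := Matrix.of fun i j => M (n + i) (n + j)

/-- The inverse of an infinite (upper or lower) triangular matrix with nonzero diagonal, whose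
finite truncations are the inverses of the truncations of the matrix. -/
def triInv (M : Matrix ℕ ℕ ℂ) : Matrix ℕ ℕ ℂ := Matrix.of fun i j =>
  (M.submatrix (fun a : Fin (max i j + 1) => (a : ℕ)) (fun b : Fin (max i j + 1) => (b : ℕ)))⁻¹
    ⟨i, by omega⟩ ⟨j, by omega⟩

/-- `W_{n+} W_+⁻¹`, where `W_{n+}` and `W_+` are the upper and lower right blocks of the upper
triangular matrix `W` of the `p_j`; the sum has only the terms allowed by triangularity. -/
def graphMatrix (n : ℕ) (p : ℕ → ℂ[X]) (a l : ℕ) : ℂ :=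
  ∑ m ∈ Finset.range (l + 1), polyMatrix p a (n + m) * triInv (plusBlock n (polyMatrix p)) m l

end KPTau

end

/-! Write L and L' for the moment functionals of V_u and V_{u+t}. Every quantity in the theorem
reduces to the number det(Hankel matrix of L') / ∏_{j<n} h_j.

Partition functions. Expanding the squared Vandermonde product over pairs of permutations and
integrating variable by variable gives n! times the Hankel determinant
(`partitionFunction_eq_det_hankel`). For L itself, a unit triangular change of basis turns the
Hankel matrix into diag(h_j) (`IsOrthogonal.det_hankel`).

Fredholm determinant. The operator factors through ℂ^n as Φ∘Λ, so its determinant is that of the n×n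
matrix 1 - ΛΦ (`fredholmDet_comp`). Since e^{-V_{u+t}} e^ξ = e^{-V_u}, pairing p_i with the tail e^ξ
p_j - r_j, where r_j is the part of degree < n, gives L(p_i p_j) - L'(p_i r_j). The first term
cancels the identity, and the r_j are again a basis of H_n with coefficient determinant 1
(`exists_integral_operator`).

Tau function. The subspace w_0 is the kernel of the L-orthogonal projection onto polynomials of
degree < n, hence the graph of a map G : H_+ → H_n. In any admissible frame the N×N truncation has
the same determinant as BG + C. Multiplying by C⁻¹, exchanging factors in det(1 + XY), and using the
off-diagonal block of e^{-ξ}e^ξ = 1, one gets an n×n determinant det(1 + T_N A). Here T_N is a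
partial sum of the expansion of e^{-ξ} under L, and it tends to Q - A⁻¹ with det Q the number above
(`IsOrthogonal.isKPTau`). The only analytic input is the termwise integration of e^{-ξ}
(`hasSum_expCoeff_mul_moment`), and this is where |t_{d+1}| must be small. The same series yields
the matrix entries of the operator. -/

noncomputable section

namespace KPTau

/-! ### Taylor series of entire functions -/

/-- The Taylor series of `f` at the origin. -/
def taylorSeries (f : ℂ → ℂ) : PowerSeries ℂ := PowerSeries.mk (taylorCoeff f)

lemma coeff_taylorSeries (f : ℂ → ℂ) (k : ℕ) :
    PowerSeries.coeff k (taylorSeries f) = taylorCoeff f k := PowerSeries.coeff_mk _ _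

lemma taylorCoeff_add {f g : ℂ → ℂ} (hf : Differentiable ℂ f) (hg : Differentiable ℂ g) (k : ℕ) :
    taylorCoeff (fun z => f z + g z) k = taylorCoeff f k + taylorCoeff g k := by
  have := iteratedDeriv_add (n := k) (x := (0 : ℂ)) hf.contDiff.contDiffAt hg.contDiff.contDiffAt
  simp only [taylorCoeff, ← add_div]
  rw [← this]
  rfl

lemma taylorCoeff_const_mul {f : ℂ → ℂ} (hf : Differentiable ℂ f) (c : ℂ) (k : ℕ) :
    taylorCoeff (fun z => c * f z) k = c * taylorCoeff f k := by
  have := iteratedDeriv_const_smul (n := k) (x := (0 : ℂ)) hf.contDiff.contDiffAt c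
  simp only [taylorCoeff, ← mul_div_assoc]
  rw [← smul_eq_mul (a := c) (b := iteratedDeriv k f 0), ← this]
  rfl

lemma taylorCoeff_sub {f g : ℂ → ℂ} (hf : Differentiable ℂ f) (hg : Differentiable ℂ g) (k : ℕ) :
    taylorCoeff (fun z => f z - g z) k = taylorCoeff f k - taylorCoeff g k := by
  have h1 := taylorCoeff_add hf (hg.const_mul (-1)) k
  rw [taylorCoeff_const_mul hg] at h1
  simpa [sub_eq_add_neg] using h1

lemma taylorCoeff_sum {ι : Type*} (s : Finset ι) {f : ι → ℂ → ℂ}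
    (hf : ∀ i, Differentiable ℂ (f i)) (k : ℕ) :
    taylorCoeff (fun z => ∑ i ∈ s, f i z) k = ∑ i ∈ s, taylorCoeff (f i) k := by
  classical
  induction s using Finset.induction_on with
  | empty =>
    have h1 : iteratedDeriv k (fun _ : ℂ => (0 : ℂ)) 0 = 0 := iteratedDeriv_const_zero
    simp [taylorCoeff, h1]
  | insert a s ha ih =>
    simp only [Finset.sum_insert ha]
    rw [taylorCoeff_add (hf a) (Differentiable.fun_sum fun i _ => hf i), ih]

lemma taylorSeries_mul {f g : ℂ → ℂ} (hf : Differentiable ℂ f) (hg : Differentiable ℂ g) :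
    taylorSeries (fun z => f z * g z) = taylorSeries f * taylorSeries g := by
  ext k
  have h1 := iteratedDeriv_mul (n := k) (x := (0 : ℂ)) hf.contDiff.contDiffAt
    hg.contDiff.contDiffAt
  have h2 : taylorCoeff (fun z => f z * g z) k = iteratedDeriv k (f * g) 0 / (k.factorial : ℂ) :=
    rfl
  rw [PowerSeries.coeff_mul, coeff_taylorSeries, h2, h1,
    Finset.Nat.sum_antidiagonal_eq_sum_range_succ_mk, Finset.sum_div]
  simp only [coeff_taylorSeries, taylorCoeff]
  refine Finset.sum_congr rfl fun i hi => ?_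
  rw [Nat.cast_choose _ (by grind)]
  field_simp [Nat.factorial_ne_zero]

lemma taylorCoeff_pow (m k : ℕ) : taylorCoeff (fun z => z ^ m) k = if k = m then 1 else 0 := by
  rw [taylorCoeff, iteratedDeriv_fun_pow_zero]
  split_ifs with h
  · subst h
    exact div_self (by exact_mod_cast Nat.factorial_ne_zero k)
  · simp

lemma taylorCoeff_eval (q : ℂ[X]) (k : ℕ) : taylorCoeff (fun z => q.eval z) k = q.coeff k := by
  have h1 : (fun z => q.eval z) = fun z => ∑ i ∈ Finset.range (q.natDegree + 1),
      q.coeff i * z ^ i := by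
    funext z
    exact Polynomial.eval_eq_sum_range z
  rw [h1, taylorCoeff_sum _ fun i => (differentiable_pow i).const_mul _]
  simp_rw [taylorCoeff_const_mul (differentiable_pow _), taylorCoeff_pow]
  simp only [mul_ite, mul_one, mul_zero, Finset.sum_ite_eq, Finset.mem_range]
  split_ifs with h
  · rfl
  · exact (Polynomial.coeff_eq_zero_of_natDegree_lt (by omega)).symm

lemma taylorSeries_eval (q : ℂ[X]) :
    taylorSeries (fun z => q.eval z) = (q : PowerSeries ℂ) := by
  ext k
  rw [coeff_taylorSeries, taylorCoeff_eval, Polynomial.coeff_coe]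

lemma taylorCoeff_succ (f : ℂ → ℂ) (k : ℕ) :
    ((k : ℂ) + 1) * taylorCoeff f (k + 1) = taylorCoeff (deriv f) k := by
  rw [taylorCoeff, taylorCoeff, iteratedDeriv_succ', Nat.factorial_succ]
  have h1 : (k.factorial : ℂ) ≠ 0 := by exact_mod_cast Nat.factorial_ne_zero k
  have h2 : (k : ℂ) + 1 ≠ 0 := by exact_mod_cast Nat.succ_ne_zero k
  push_cast
  field_simp

lemma hasSum_taylorCoeff {f : ℂ → ℂ} (hf : Differentiable ℂ f) (z : ℂ) :
    HasSum (fun k => taylorCoeff f k * z ^ k) (f z) := by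
  have h1 := Complex.hasSum_taylorSeries_of_entire hf 0 z
  have h2 : (fun k => taylorCoeff f k * z ^ k) =
      fun n : ℕ => ((n.factorial : ℂ)⁻¹) • (z - 0) ^ n • iteratedDeriv n f 0 := by
    funext k
    rw [taylorCoeff, sub_zero, smul_eq_mul, smul_eq_mul]
    ring
  rwa [h2]

lemma differentiable_eval (q : ℂ[X]) : Differentiable ℂ fun z => q.eval z := q.differentiable

lemma differentiable_cexp_eval (q : ℂ[X]) : Differentiable ℂ fun z => Complex.exp (q.eval z) :=
  (differentiable_eval q).cexp

/-- This is (e^q)' = q' e^q read on coefficients. It is a recursion through which a coefficientwise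
majorant of q propagates to e^q. -/
lemma succ_mul_taylorCoeff_cexp_eval (q : ℂ[X]) (k : ℕ) :
    ((k : ℂ) + 1) * taylorCoeff (fun z => Complex.exp (q.eval z)) (k + 1) =
      ∑ ij ∈ Finset.HasAntidiagonal.antidiagonal k, q.derivative.coeff ij.1 *
        taylorCoeff (fun z => Complex.exp (q.eval z)) ij.2 := by
  have h1 : deriv (fun z => Complex.exp (q.eval z)) =
      fun z => q.derivative.eval z * Complex.exp (q.eval z) := by
    funext z
    rw [((q.hasDerivAt z).cexp).deriv, mul_comm]
  rw [taylorCoeff_succ, h1, ← coeff_taylorSeries,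
    taylorSeries_mul (differentiable_eval _) (differentiable_cexp_eval q), PowerSeries.coeff_mul]
  simp only [coeff_taylorSeries, taylorCoeff_eval]

lemma taylorCoeff_zero (f : ℂ → ℂ) : taylorCoeff f 0 = f 0 := by simp [taylorCoeff]

/-- The Taylor coefficients of `e^q` are dominated by those of `e^Q` if the coefficients of `q`
are dominated by those of `Q`. -/
lemma exists_norm_taylorCoeff_cexp_le {q Q : ℂ[X]} (hq : q.coeff 0 = 0) (hQ : Q.coeff 0 = 0)
    (h : ∀ i, ∃ b : ℝ, Q.coeff i = b ∧ ‖q.coeff i‖ ≤ b) (k : ℕ) :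
    ∃ r : ℝ, taylorCoeff (fun z => Complex.exp (Q.eval z)) k = r ∧
      ‖taylorCoeff (fun z => Complex.exp (q.eval z)) k‖ ≤ r := by
  choose b hb hqb using h
  induction k using Nat.strong_induction_on with
  | _ k ih =>
    rcases k with _ | k
    · refine ⟨1, ?_, ?_⟩ <;> rw [taylorCoeff_zero] <;>
        simp [← Polynomial.coeff_zero_eq_eval_zero, hq, hQ]
    · have h2 : (k : ℂ) + 1 ≠ 0 := by exact_mod_cast Nat.succ_ne_zero k
      -- The bound is made total in j, with the irrelevant value 0 beyond k, so that it can be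
      -- chosen as a function.
      have ih' : ∀ j, ∃ r : ℝ, j ≤ k → taylorCoeff (fun z => Complex.exp (Q.eval z)) j = r ∧
          ‖taylorCoeff (fun z => Complex.exp (q.eval z)) j‖ ≤ r := by
        intro j
        by_cases hj : j ≤ k
        · obtain ⟨r, hr⟩ := ih j (by omega)
          exact ⟨r, fun _ => hr⟩
        · exact ⟨0, fun h => absurd h hj⟩
      choose r hr using ih'
      refine ⟨(∑ ij ∈ Finset.HasAntidiagonal.antidiagonal k, b (ij.1 + 1) * (ij.1 + 1) * r ij.2) / (k + 1), ?_, ?_⟩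
      · push_cast
        rw [eq_div_iff h2, mul_comm, succ_mul_taylorCoeff_cexp_eval]
        refine Finset.sum_congr rfl fun ij hij => ?_
        have := Finset.HasAntidiagonal.mem_antidiagonal.mp hij
        rw [(hr ij.2 (by omega)).1, Polynomial.coeff_derivative, hb]
      · have h3 : ‖((k : ℂ) + 1)‖ = (k : ℝ) + 1 := by
          exact_mod_cast Complex.norm_natCast (k + 1)
        rw [le_div_iff₀ (by positivity), mul_comm, ← h3, ← norm_mul,
          succ_mul_taylorCoeff_cexp_eval]
        refine (norm_sum_le _ _).trans (Finset.sum_le_sum fun ij hij => ?_)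
        have := Finset.HasAntidiagonal.mem_antidiagonal.mp hij
        rw [norm_mul, Polynomial.coeff_derivative, norm_mul]
        have h4 : ‖((ij.1 : ℂ) + 1)‖ = (ij.1 : ℝ) + 1 := by
          exact_mod_cast Complex.norm_natCast (ij.1 + 1)
        rw [h4]
        have h5 := hqb (ij.1 + 1)
        have h6 := (hr ij.2 (by omega)).2
        have h7 : 0 ≤ b (ij.1 + 1) := (norm_nonneg _).trans h5
        gcongr

/-! ### The potential as a polynomial -/

/-- The potential as a polynomial. -/
def potentialPoly (d : ℕ) (a : ℕ → ℂ) : ℂ[X] :=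
  ∑ K ∈ Finset.Icc 1 (d + 1), monomial K (a K / K)

lemma eval_potentialPoly (d : ℕ) (a : ℕ → ℂ) (x : ℂ) :
    (potentialPoly d a).eval x = potential d a x := by
  simp only [potentialPoly, potential, Polynomial.eval_finsetSum, Polynomial.eval_monomial]
  exact Finset.sum_congr rfl fun K _ => by ring

lemma coeff_potentialPoly (d : ℕ) (a : ℕ → ℂ) (i : ℕ) :
    (potentialPoly d a).coeff i = if i ∈ Finset.Icc 1 (d + 1) then a i / i else 0 := by
  simp [potentialPoly, Polynomial.finsetSum_coeff, Polynomial.coeff_monomial]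

lemma potential_add (d : ℕ) (a b : ℕ → ℂ) (x : ℂ) :
    potential d (a + b) x = potential d a x + potential d b x := by
  simp only [potential, Pi.add_apply, ← Finset.sum_add_distrib]
  exact Finset.sum_congr rfl fun K _ => by ring

lemma potential_neg (d : ℕ) (a : ℕ → ℂ) (x : ℂ) : potential d (-a) x = -potential d a x := by
  simp only [potential, Pi.neg_apply, ← Finset.sum_neg_distrib]
  exact Finset.sum_congr rfl fun K _ => by ring

lemma differentiable_potential (d : ℕ) (a : ℕ → ℂ) : Differentiable ℂ (potential d a) := by
  rw [← funext (eval_potentialPoly d a)]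
  exact differentiable_eval _

/-- The Taylor coefficients of `exp (∑ a_K z^K / K)`. -/
def expCoeff (d : ℕ) (a : ℕ → ℂ) (k : ℕ) : ℂ :=
  taylorCoeff (fun z => Complex.exp (potential d a z)) k

/-- The Taylor series of `exp (∑ a_K z^K / K)`. -/
def expSeries (d : ℕ) (a : ℕ → ℂ) : PowerSeries ℂ := PowerSeries.mk (expCoeff d a)

lemma differentiable_cexp_potential (d : ℕ) (a : ℕ → ℂ) :
    Differentiable ℂ fun z => Complex.exp (potential d a z) :=
  (differentiable_potential d a).cexp

lemma hasSum_expCoeff (d : ℕ) (a : ℕ → ℂ) (z : ℂ) :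
    HasSum (fun k => expCoeff d a k * z ^ k) (Complex.exp (potential d a z)) :=
  hasSum_taylorCoeff (differentiable_cexp_potential d a) z

lemma expSeries_mul_expSeries_neg (d : ℕ) (a : ℕ → ℂ) :
    expSeries d (-a) * expSeries d a = 1 := by
  have h1 := taylorSeries_mul (differentiable_cexp_potential d (-a))
    (differentiable_cexp_potential d a)
  have h2 : (fun z => Complex.exp (potential d (-a) z) * Complex.exp (potential d a z)) =
      fun z => (1 : ℂ[X]).eval z := by
    funext z
    rw [← Complex.exp_add, potential_neg]
    simp
  rw [h2, taylorSeries_eval] at h1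
  exact h1.symm.trans (by simp)

lemma expCoeff_zero (d : ℕ) (a : ℕ → ℂ) : expCoeff d a 0 = 1 := by
  rw [expCoeff, taylorCoeff_zero, ← eval_potentialPoly, ← Polynomial.coeff_zero_eq_eval_zero,
    coeff_potentialPoly]
  simp

lemma differentiable_flow {d : ℕ} {t : ℕ → ℂ} {f : ℂ → ℂ} (hf : Differentiable ℂ f) :
    Differentiable ℂ (flow d t f) := (differentiable_cexp_potential d t).mul hf

lemma taylorSeries_flow_eval (d : ℕ) (t : ℕ → ℂ) (q : ℂ[X]) :
    taylorSeries (flow d t fun z => q.eval z) = expSeries d t * (q : PowerSeries ℂ) := by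
  rw [← taylorSeries_eval]
  exact taylorSeries_mul (differentiable_cexp_potential d t) (differentiable_eval q)

lemma exists_norm_expCoeff_neg_le (d : ℕ) (t : ℕ → ℂ) (k : ℕ) :
    ∃ r : ℝ, expCoeff d (fun i => (‖t i‖ : ℂ)) k = r ∧ ‖expCoeff d (-t) k‖ ≤ r := by
  simp only [expCoeff, ← eval_potentialPoly]
  refine exists_norm_taylorCoeff_cexp_le (by simp [coeff_potentialPoly])
    (by simp [coeff_potentialPoly]) (fun i => ?_) k
  refine ⟨if i ∈ Finset.Icc 1 (d + 1) then ‖t i‖ / i else 0, ?_, ?_⟩ <;>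
    rw [coeff_potentialPoly] <;> split_ifs <;> simp

/-- The coefficient of `z^i` in `exp (∑ a_K z^K / K) z^j`. -/
def shiftCoeff (d : ℕ) (a : ℕ → ℂ) (i j : ℕ) : ℂ := if j ≤ i then expCoeff d a (i - j) else 0

lemma coeff_expSeries_mul (d : ℕ) (a : ℕ → ℂ) (q : PowerSeries ℂ) (i N : ℕ) (hN : i < N) :
    PowerSeries.coeff i (expSeries d a * q) =
      ∑ j ∈ Finset.range N, shiftCoeff d a i j * PowerSeries.coeff j q := by
  rw [mul_comm, PowerSeries.coeff_mul, Finset.Nat.sum_antidiagonal_eq_sum_range_succ_mk]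
  simp only [expSeries, PowerSeries.coeff_mk, shiftCoeff, ite_mul, zero_mul]
  rw [← Finset.sum_filter]
  refine Finset.sum_congr (by ext; simp; omega) fun j _ => mul_comm _ _

lemma coeff_expSeries_mul_X_pow (d : ℕ) (a : ℕ → ℂ) (i j : ℕ) :
    PowerSeries.coeff i (expSeries d a * PowerSeries.X ^ j) = shiftCoeff d a i j := by
  rw [PowerSeries.coeff_mul_X_pow', shiftCoeff]
  simp [expSeries]

lemma taylorCoeff_flow_eval (d : ℕ) (t : ℕ → ℂ) (q : ℂ[X]) (i N : ℕ) (hN : i < N) :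
    taylorCoeff (flow d t fun z => q.eval z) i =
      ∑ j ∈ Finset.range N, shiftCoeff d t i j * q.coeff j := by
  rw [← coeff_taylorSeries, taylorSeries_flow_eval, coeff_expSeries_mul _ _ _ _ N hN]
  simp

lemma flowMatrix_apply (d : ℕ) (t : ℕ → ℂ) (i j : ℕ) :
    flowMatrix d t i j = shiftCoeff d t i j := by
  have h1 := taylorSeries_flow_eval d t (X ^ j)
  rw [← coeff_expSeries_mul_X_pow]
  simp only [Polynomial.eval_pow, Polynomial.eval_X, Polynomial.coe_pow, Polynomial.coe_X] at h1
  rw [← h1, coeff_taylorSeries]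
  rfl

/-- This is e^{-ξ}e^ξ = 1 as a matrix identity. Lower triangularity makes every truncation that
contains row i exact. -/
lemma sum_shiftCoeff_neg_mul (d : ℕ) (t : ℕ → ℂ) (i j N : ℕ) (hN : i < N) :
    ∑ l ∈ Finset.range N, shiftCoeff d (-t) i l * shiftCoeff d t l j = if i = j then 1 else 0 := by
  have h1 := coeff_expSeries_mul d (-t) (expSeries d t * PowerSeries.X ^ j) i N hN
  simp only [coeff_expSeries_mul_X_pow] at h1
  rw [← h1, ← mul_assoc, expSeries_mul_expSeries_neg, one_mul, PowerSeries.coeff_X_pow]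

lemma shiftCoeff_self (d : ℕ) (a : ℕ → ℂ) (i : ℕ) : shiftCoeff d a i i = 1 := by
  simp [shiftCoeff, expCoeff_zero]

lemma shiftCoeff_of_lt (d : ℕ) (a : ℕ → ℂ) {i j : ℕ} (h : i < j) : shiftCoeff d a i j = 0 := by
  simp [shiftCoeff, h]

lemma shiftCoeff_add (d : ℕ) (a : ℕ → ℂ) (m i j : ℕ) :
    shiftCoeff d a (m + i) (m + j) = shiftCoeff d a i j := by
  simp [shiftCoeff, Nat.add_sub_add_left]

lemma hasSum_of_forall_eq {E : Type*} [AddCommMonoid E] [TopologicalSpace E] {f g : ℕ → E} {a : E}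
    (hg : HasSum g a) (h : ∀ l, f l = g l) : HasSum f a := by
  rwa [funext h]

/-! ### Growth of the potential along the contours -/

/-- The argument of u_{d+1} c^{d+1} is arg(u_{d+1}) + (d+1)θ, and the sector with index 2k is
exactly the condition that this lie within π/2 of 2πk. -/
lemma re_pos_of_mem_sector {d : ℕ} {u : ℕ → ℂ} (hu : u (d + 1) ≠ 0) {k : ℕ} {c : ℂ}
    (hc : c ∈ sector d u (2 * k)) : 0 < (u (d + 1) * c ^ (d + 1)).re := by
  obtain ⟨r, θ, hr, h1, h2, rfl⟩ := hc
  have hd : (0 : ℝ) < d + 1 := by positivity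
  set α := Complex.arg (u (d + 1)) with hα
  have h3 : u (d + 1) * ((r : ℂ) * Complex.exp (θ * Complex.I)) ^ (d + 1) =
      ((‖u (d + 1)‖ * r ^ (d + 1) : ℝ) : ℂ) *
        Complex.exp (((α + (d + 1) * θ : ℝ) : ℂ) * Complex.I) := by
    conv_lhs => rw [← Complex.norm_mul_exp_arg_mul_I (u (d + 1)), ← hα]
    rw [mul_pow, ← Complex.exp_nat_mul]
    push_cast
    rw [show ((α : ℂ) + (d + 1) * θ) * Complex.I =
      α * Complex.I + (d + 1) * (θ * Complex.I) by ring, Complex.exp_add]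
    ring
  rw [h3, Complex.re_ofReal_mul, Complex.exp_ofReal_mul_I_re]
  have h4 : 0 < Real.cos (α + (d + 1) * θ) := by
    rw [← Real.cos_sub_nat_mul_two_pi _ k]
    have e1 : (-α / (d + 1) + (2 * ((2 * k : ℕ) : ℝ) - 1) * Real.pi / (2 * (d + 1))) * (d + 1) =
        -α + (4 * k - 1) * Real.pi / 2 := by
      push_cast
      field_simp
      ring
    have e2 : (-α / (d + 1) + (2 * ((2 * k : ℕ) : ℝ) + 1) * Real.pi / (2 * (d + 1))) * (d + 1) =
        -α + (4 * k + 1) * Real.pi / 2 := by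
      push_cast
      field_simp
      ring
    have h5 := mul_lt_mul_of_pos_right h1 hd
    have h6 := mul_lt_mul_of_pos_right h2 hd
    rw [e1] at h5
    rw [e2] at h6
    apply Real.cos_pos_of_mem_Ioo
    constructor <;> linarith
  have h7 : 0 < ‖u (d + 1)‖ := norm_pos_iff.mpr hu
  positivity

lemma tendsto_potential_div {d : ℕ} (a : ℕ → ℂ) {γ : ℝ → ℂ} {c : ℂ} {l : Filter ℝ}
    (hl : Tendsto (fun s : ℝ => |s|) l atTop)
    (hγ : Tendsto (fun s : ℝ => γ s / ((|s| : ℝ) : ℂ)) l (𝓝 c)) :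
    Tendsto (fun s => potential d a (γ s) / ((|s| ^ (d + 1) : ℝ) : ℂ)) l
      (𝓝 (a (d + 1) * c ^ (d + 1) / (d + 1))) := by
  have hinv : Tendsto (fun s : ℝ => (((|s|)⁻¹ : ℝ) : ℂ)) l (𝓝 0) := by
    have := (Complex.continuous_ofReal.tendsto 0).comp (tendsto_inv_atTop_zero.comp hl)
    simpa [Function.comp_def] using this
  -- The factor 0^(d+1-K) is the limit of |s|^{-(d+1-K)}. It equals 1 for K = d+1 and 0 for the
  -- lower terms, so one formula covers all K.
  have hterm : ∀ K ∈ Finset.Icc 1 (d + 1),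
      Tendsto (fun s : ℝ => a K * γ s ^ K / (K : ℂ) / ((|s| ^ (d + 1) : ℝ) : ℂ)) l
        (𝓝 (a K * c ^ K / K * 0 ^ (d + 1 - K))) := by
    intro K hK
    have h1 := (((hγ.pow K).const_mul (a K)).div_const (K : ℂ)).mul (hinv.pow (d + 1 - K))
    refine h1.congr' ?_
    filter_upwards [hl.eventually_gt_atTop 0] with s hs
    have hs' : ((|s| : ℝ) : ℂ) ≠ 0 := by exact_mod_cast hs.ne'
    have hK' := Finset.mem_Icc.mp hK
    have h2 : ((|s| ^ (d + 1) : ℝ) : ℂ) = ((|s| : ℝ) : ℂ) ^ K * ((|s| : ℝ) : ℂ) ^ (d + 1 - K) := by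
      rw [← pow_add, Nat.add_sub_cancel' hK'.2]
      push_cast
      rfl
    rw [h2]
    push_cast
    rw [div_pow, inv_pow]
    field_simp
  have h2 := tendsto_finsetSum _ hterm
  have h3 : ∑ K ∈ Finset.Icc 1 (d + 1), a K * c ^ K / K * 0 ^ (d + 1 - K) =
      a (d + 1) * c ^ (d + 1) / (d + 1) := by
    rw [Finset.sum_eq_single_of_mem (d + 1) (by simp)]
    · simp
    · intro K hK hne
      have := Finset.mem_Icc.mp hK
      rw [zero_pow (by omega), mul_zero]
  rw [h3] at h2
  refine h2.congr fun s => ?_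
  rw [potential, Finset.sum_div]

/-- Eventually F(s) ≤ -y with y = (-α/2)|s|, and e^{-y} ≤ 2/y². Together with 1 + s² ≤ 2s² for |s| ≥
1 this gives the constant 4/(-α/2)². -/
lemma isBigO_exp_of_tendsto_neg {F : ℝ → ℝ} {N : ℕ} {α : ℝ} {l : Filter ℝ}
    (hl : Tendsto (fun s : ℝ => |s|) l atTop)
    (hα : α < 0) (hF : Tendsto (fun s => F s / |s| ^ (N + 1)) l (𝓝 α)) :
    (fun s => Real.exp (F s)) =O[l] fun s : ℝ => (1 + s ^ 2)⁻¹ := by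
  refine Asymptotics.IsBigO.of_bound (4 / (-α / 2) ^ 2) ?_
  filter_upwards [hl.eventually_ge_atTop 1, hF.eventually_lt_const (show α < α / 2 by linarith)]
    with s hs hFs
  have hs0 : 0 < |s| := by linarith
  rw [div_lt_iff₀ (by positivity)] at hFs
  have h1 : |s| ≤ |s| ^ (N + 1) := le_self_pow₀ hs (by omega)
  have h2 : F s ≤ -(-α / 2 * |s|) := by nlinarith
  have h3 : (-α / 2 * |s|) ^ 2 / 2 ≤ Real.exp (-α / 2 * |s|) := by
    have := Real.pow_div_factorial_le_exp (x := -α / 2 * |s|)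
      (mul_nonneg (by linarith) hs0.le) 2
    simpa using this
  have h4 : (0 : ℝ) < (-α / 2) ^ 2 := by nlinarith
  have h5 : 1 + s ^ 2 ≤ 2 * s ^ 2 := by
    have := sq_abs s
    nlinarith
  rw [Real.norm_of_nonneg (Real.exp_pos _).le, Real.norm_of_nonneg (by positivity)]
  refine (Real.exp_le_exp.mpr h2).trans ?_
  rw [Real.exp_neg, ← div_eq_mul_inv, div_div, inv_le_comm₀ (Real.exp_pos _) (by positivity),
    inv_div, div_le_iff₀ (by norm_num)]
  have h6 : (-α / 2 * |s|) ^ 2 = (-α / 2) ^ 2 * s ^ 2 := by rw [mul_pow, sq_abs]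
  rw [h6] at h3
  nlinarith

lemma integrable_exp_of_tendsto_neg {F : ℝ → ℝ} (hc : Continuous F) {N : ℕ} {α β : ℝ}
    (hα : α < 0) (hβ : β < 0) (hF : Tendsto (fun s => F s / |s| ^ (N + 1)) atBot (𝓝 α))
    (hF' : Tendsto (fun s => F s / |s| ^ (N + 1)) atTop (𝓝 β)) :
    Integrable fun s => Real.exp (F s) :=
  (Real.continuous_exp.comp hc).locallyIntegrable.integrable_of_isBigO_atBot_atTop
    (isBigO_exp_of_tendsto_neg tendsto_abs_atBot_atTop hα hF)
    (integrable_inv_one_add_sq.integrableAtFilter _)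
    (isBigO_exp_of_tendsto_neg tendsto_abs_atTop_atTop hβ hF')
    (integrable_inv_one_add_sq.integrableAtFilter _)

section Contours

variable {d : ℕ} {u : ℕ → ℂ} {Γ : Fin d → ℝ → ℂ} {cIn cOut : Fin d → ℂ}

lemma IsContourSystem.re_pos (hΓ : IsContourSystem d u Γ cIn cOut) (hu : u (d + 1) ≠ 0)
    (k : Fin d) :
    0 < (u (d + 1) * cIn k ^ (d + 1)).re ∧ 0 < (u (d + 1) * cOut k ^ (d + 1)).re :=
  ⟨re_pos_of_mem_sector hu (hΓ.cIn_mem k),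
    re_pos_of_mem_sector (k := k + 1) hu (by simpa [mul_add] using hΓ.cOut_mem k)⟩

lemma IsContourSystem.continuous (hΓ : IsContourSystem d u Γ cIn cOut) (k : Fin d) :
    Continuous (Γ k) := (hΓ.lipschitz k).choose_spec.continuous

/-- The exponent of the integrable majorants `exp (-Re V(x) + ∑ τ_J |x|^J / J)`. -/
def growth (d : ℕ) (v τ : ℕ → ℂ) (x : ℂ) : ℝ :=
  -(potential d v x).re + (potential d τ (‖x‖ : ℂ)).re

lemma continuous_growth (v τ : ℕ → ℂ) : Continuous (growth d v τ) := by
  have h1 := (differentiable_potential d v).continuous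
  have h2 := (differentiable_potential d τ).continuous
  unfold growth
  fun_prop

lemma tendsto_growth_div (v τ : ℕ → ℂ) {γ : ℝ → ℂ} {c : ℂ} {l : Filter ℝ}
    (hl : Tendsto (fun s : ℝ => |s|) l atTop)
    (hγ : Tendsto (fun s : ℝ => γ s / ((|s| : ℝ) : ℂ)) l (𝓝 c)) :
    Tendsto (fun s => growth d v τ (γ s) / |s| ^ (d + 1)) l
      (𝓝 ((-(v (d + 1) * c ^ (d + 1)).re + (τ (d + 1)).re * ‖c‖ ^ (d + 1)) / (d + 1))) := by
  have h1 := (Complex.continuous_re.tendsto _).comp (tendsto_potential_div (d := d) v hl hγ)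
  have hγ' : Tendsto (fun s : ℝ => ((‖γ s‖ : ℝ) : ℂ) / ((|s| : ℝ) : ℂ)) l (𝓝 (‖c‖ : ℂ)) := by
    have := (Complex.continuous_ofReal.tendsto _).comp hγ.norm
    refine this.congr fun s => ?_
    simp
  have h2 := (Complex.continuous_re.tendsto _).comp (tendsto_potential_div (d := d) τ hl hγ')
  have h3 := h1.neg.add h2
  have e : ∀ z : ℂ, (z / ((d : ℂ) + 1)).re = z.re / (d + 1) := fun z => by
    have := Complex.div_ofReal_re z ((d : ℝ) + 1)
    push_cast at this
    exact this
  have e2 : (τ (d + 1) * (‖c‖ : ℂ) ^ (d + 1)).re = (τ (d + 1)).re * ‖c‖ ^ (d + 1) := by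
    rw [← Complex.ofReal_pow, Complex.re_mul_ofReal]
  rw [e, e, e2] at h3
  have h4 : (-(v (d + 1) * c ^ (d + 1)).re + (τ (d + 1)).re * ‖c‖ ^ (d + 1)) / ((d : ℝ) + 1) =
      -((v (d + 1) * c ^ (d + 1)).re / (d + 1)) +
        (τ (d + 1)).re * ‖c‖ ^ (d + 1) / ((d : ℝ) + 1) := by ring
  rw [h4]
  refine h3.congr fun s => ?_
  simp only [Function.comp, growth, Complex.div_ofReal_re]
  ring

lemma integrable_exp_growth (hΓ : IsContourSystem d u Γ cIn cOut) (v τ : ℕ → ℂ) (k : Fin d)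
    (hin : (τ (d + 1)).re * ‖cIn k‖ ^ (d + 1) < (v (d + 1) * cIn k ^ (d + 1)).re)
    (hout : (τ (d + 1)).re * ‖cOut k‖ ^ (d + 1) < (v (d + 1) * cOut k ^ (d + 1)).re) :
    Integrable fun s => Real.exp (growth d v τ (Γ k s)) := by
  refine integrable_exp_of_tendsto_neg ((continuous_growth v τ).comp (hΓ.continuous k)) ?_ ?_
    (tendsto_growth_div v τ tendsto_abs_atBot_atTop (hΓ.tendsto_in k))
    (tendsto_growth_div v τ tendsto_abs_atTop_atTop (hΓ.tendsto_out k))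
  · exact div_neg_of_neg_of_pos (by linarith) (by positivity)
  · exact div_neg_of_neg_of_pos (by linarith) (by positivity)

/-- Raising the linear coefficient of τ by 1 buys a factor e^{|x|}, which absorbs any polynomial. -/
lemma growth_add_single (v τ : ℕ → ℂ) (x : ℂ) :
    growth d v (τ + Pi.single 1 1) x = growth d v τ x + ‖x‖ := by
  have h1 : potential d (Pi.single 1 1) (‖x‖ : ℂ) = ‖x‖ := by
    rw [potential, Finset.sum_eq_single_of_mem 1 (by simp)]
    · simp
    · intro K _ hne
      simp [Pi.single_eq_of_ne hne]
  rw [growth, potential_add, h1, growth, Complex.add_re, Complex.ofReal_re]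
  ring

lemma integrable_growth_eval (hΓ : IsContourSystem d u Γ cIn cOut) (v τ : ℕ → ℂ) (k : Fin d)
    (hin : (τ (d + 1)).re * ‖cIn k‖ ^ (d + 1) < (v (d + 1) * cIn k ^ (d + 1)).re)
    (hout : (τ (d + 1)).re * ‖cOut k‖ ^ (d + 1) < (v (d + 1) * cOut k ^ (d + 1)).re)
    (q : ℂ[X]) :
    Integrable fun s => (Real.exp (growth d v τ (Γ k s)) : ℂ) * q.eval (Γ k s) *
      deriv (Γ k) s := by
  obtain ⟨C, hC⟩ := hΓ.lipschitz k
  have hc := hΓ.continuous k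
  have hg := (continuous_growth (d := d) v τ).comp hc
  induction q using Polynomial.induction_on' with
  | add p q hp hq =>
    refine (hp.add hq).congr (Eventually.of_forall fun s => ?_)
    simp only [Pi.add_apply, Polynomial.eval_add]
    ring
  | monomial m a =>
    -- The existence of the index k forces d ≥ 1, so changing τ at index 1 leaves the leading
    -- coefficient, and with it the integrability condition, untouched.
    have hd : d + 1 ≠ 1 := by
      have := k.pos
      omega
    have h1 := integrable_exp_growth hΓ v (τ + Pi.single 1 1) k
      (by simpa [Pi.single_eq_of_ne hd] using hin) (by simpa [Pi.single_eq_of_ne hd] using hout)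
    refine (h1.const_mul (‖a‖ * m.factorial * C)).mono' ?_ (Eventually.of_forall fun s => ?_)
    · refine (Continuous.aestronglyMeasurable ?_).mul (measurable_deriv _).aestronglyMeasurable
      have hq := (differentiable_eval (monomial m a)).continuous.comp hc
      exact (Complex.continuous_ofReal.comp (Real.continuous_exp.comp hg)).mul hq
    · have h2 : ‖deriv (Γ k) s‖ ≤ C := norm_deriv_le_of_lipschitz hC
      have h3 := Real.pow_div_factorial_le_exp (x := ‖Γ k s‖) (norm_nonneg _) m
      rw [div_le_iff₀ (by positivity)] at h3
      rw [growth_add_single, Real.exp_add, norm_mul, norm_mul, Polynomial.eval_monomial, norm_mul,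
        norm_pow, Complex.norm_real, Real.norm_of_nonneg (Real.exp_pos _).le]
      calc Real.exp (growth d v τ (Γ k s)) * (‖a‖ * ‖Γ k s‖ ^ m) * ‖deriv (Γ k) s‖
          ≤ Real.exp (growth d v τ (Γ k s)) * (‖a‖ * (Real.exp ‖Γ k s‖ * m.factorial)) * C := by
            gcongr
        _ = _ := by ring

lemma growth_zero (v : ℕ → ℂ) (x : ℂ) : growth d v 0 x = -(potential d v x).re := by
  simp [growth, potential]

/-! ### Contour integrals -/

/-- Absolute convergence of `∫_{Γ_k} f(x) dx` for all `k`. -/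
def ContourIntegrable (Γ : Fin d → ℝ → ℂ) (f : ℂ → ℂ) : Prop :=
  ∀ k, Integrable fun s : ℝ => f (Γ k s) * deriv (Γ k) s

lemma ContourIntegrable.add {f g : ℂ → ℂ} (hf : ContourIntegrable Γ f)
    (hg : ContourIntegrable Γ g) : ContourIntegrable Γ fun x => f x + g x := fun k =>
  ((hf k).add (hg k)).congr (Eventually.of_forall fun s => by simp [add_mul])

lemma ContourIntegrable.const_mul {f : ℂ → ℂ} (hf : ContourIntegrable Γ f) (c : ℂ) :
    ContourIntegrable Γ fun x => c * f x := fun k =>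
  ((hf k).const_mul c).congr (Eventually.of_forall fun s => by ring)

lemma contourIntegral_add (ϰ : Fin d → ℂ) {f g : ℂ → ℂ} (hf : ContourIntegrable Γ f)
    (hg : ContourIntegrable Γ g) :
    contourIntegral ϰ Γ (fun x => f x + g x) = contourIntegral ϰ Γ f + contourIntegral ϰ Γ g := by
  simp only [contourIntegral, ← Finset.sum_add_distrib, ← mul_add, add_mul]
  exact Finset.sum_congr rfl fun k _ => by rw [integral_add (hf k) (hg k)]

lemma contourIntegral_const_mul (ϰ : Fin d → ℂ) (c : ℂ) (f : ℂ → ℂ) :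
    contourIntegral ϰ Γ (fun x => c * f x) = c * contourIntegral ϰ Γ f := by
  simp only [contourIntegral, Finset.mul_sum, mul_assoc c]
  exact Finset.sum_congr rfl fun k _ => by rw [integral_const_mul]; ring

lemma contourIntegral_sub (ϰ : Fin d → ℂ) {f g : ℂ → ℂ} (hf : ContourIntegrable Γ f)
    (hg : ContourIntegrable Γ g) :
    contourIntegral ϰ Γ (fun x => f x - g x) = contourIntegral ϰ Γ f - contourIntegral ϰ Γ g := by
  have h1 := contourIntegral_add ϰ hf (hg.const_mul (-1))
  rw [contourIntegral_const_mul] at h1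
  simpa [sub_eq_add_neg] using h1

lemma contourIntegral_sum (ϰ : Fin d → ℂ) {ι : Type*} (s : Finset ι) {f : ι → ℂ → ℂ}
    (hf : ∀ i, ContourIntegrable Γ (f i)) :
    ContourIntegrable Γ (fun x => ∑ i ∈ s, f i x) ∧
    contourIntegral ϰ Γ (fun x => ∑ i ∈ s, f i x) = ∑ i ∈ s, contourIntegral ϰ Γ (f i) := by
  classical
  induction s using Finset.induction_on with
  | empty => exact ⟨fun k => by simp, by simp [contourIntegral]⟩
  | insert a s ha ih =>
    simp only [Finset.sum_insert ha]
    exact ⟨(hf a).add ih.1, by rw [contourIntegral_add ϰ (hf a) ih.1, ih.2]⟩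

lemma contourIntegrable_cexp_eval (hΓ : IsContourSystem d u Γ cIn cOut) {v : ℕ → ℂ}
    (hv : ∀ k, 0 < (v (d + 1) * cIn k ^ (d + 1)).re ∧ 0 < (v (d + 1) * cOut k ^ (d + 1)).re)
    (q : ℂ[X]) : ContourIntegrable Γ fun x => Complex.exp (-potential d v x) * q.eval x := by
  intro k
  have h1 := integrable_growth_eval hΓ v 0 k (by simpa using (hv k).1) (by simpa using (hv k).2) q
  refine h1.mono ?_ (Eventually.of_forall fun s => ?_)
  · refine (Continuous.aestronglyMeasurable ?_).mul (measurable_deriv _).aestronglyMeasurable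
    have hq := (differentiable_eval q).continuous
    have hp := (differentiable_potential d v).continuous
    exact ((hp.neg.cexp).mul hq).comp (hΓ.continuous k)
  · simp only [norm_mul, growth_zero, Complex.norm_exp, Complex.neg_re, Complex.norm_real,
      Real.norm_of_nonneg (Real.exp_pos _).le, le_refl]

/-- The moment functional as a linear functional on polynomials. -/
def momentLinear (v : ℕ → ℂ) (ϰ : Fin d → ℂ) (Γ : Fin d → ℝ → ℂ)
    (hv : ∀ q : ℂ[X], ContourIntegrable Γ fun x => Complex.exp (-potential d v x) * q.eval x) :
    ℂ[X] →ₗ[ℂ] ℂ where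
  toFun := momentFunctional v ϰ Γ
  map_add' p q := by
    simp only [momentFunctional, Polynomial.eval_add, mul_add]
    exact contourIntegral_add ϰ (hv p) (hv q)
  map_smul' c p := by
    simp only [momentFunctional, Polynomial.eval_smul, smul_eq_mul, RingHom.id_apply,
      mul_left_comm _ c]
    exact contourIntegral_const_mul ϰ c _

/-- Expand e^{-ξ_t} inside the integral for V_{u+t} and integrate term by term. The coefficients of
e^{-ξ_t} are dominated by those of the exponential with coefficients ‖t_J‖, so the series of
absolute values is at most exp(∑ ‖t_J‖ |x|^J/J) |e^{-V_u} q|. The hypothesis on t_{d+1} makes this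
integrable, and dominated convergence applies. -/
lemma hasSum_expCoeff_mul_moment (hΓ : IsContourSystem d u Γ cIn cOut) (t : ℕ → ℂ)
    (ϰ : Fin d → ℂ)
    (ht : ∀ k, ‖t (d + 1)‖ * ‖cIn k‖ ^ (d + 1) < (u (d + 1) * cIn k ^ (d + 1)).re ∧
      ‖t (d + 1)‖ * ‖cOut k‖ ^ (d + 1) < (u (d + 1) * cOut k ^ (d + 1)).re) (q : ℂ[X]) :
    HasSum (fun l => expCoeff d (-t) l * momentFunctional u ϰ Γ (X ^ l * q))
      (momentFunctional (u + t) ϰ Γ q) := by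
  have hterm : ∀ k : Fin d, HasSum (fun l => ∫ s : ℝ, expCoeff d (-t) l *
        (Complex.exp (-potential d u (Γ k s)) * (X ^ l * q).eval (Γ k s) * deriv (Γ k) s))
      (∫ s : ℝ, Complex.exp (-potential d (u + t) (Γ k s)) * q.eval (Γ k s) *
        deriv (Γ k) s) := by
    intro k
    set τ : ℕ → ℂ := fun i => (‖t i‖ : ℂ) with hτ
    choose r hr hr' using exists_norm_expCoeff_neg_le d t
    have hsum : ∀ s, HasSum (fun l => r l * ‖Γ k s‖ ^ l *
        ‖Complex.exp (-potential d u (Γ k s)) * q.eval (Γ k s) * deriv (Γ k) s‖)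
        ((Complex.exp (potential d τ ‖Γ k s‖)).re *
          ‖Complex.exp (-potential d u (Γ k s)) * q.eval (Γ k s) * deriv (Γ k) s‖) := by
      intro s
      have h1 := (Complex.hasSum_iff _ _).mp (hasSum_expCoeff d τ (‖Γ k s‖ : ℂ))
      refine HasSum.mul_right _ ?_
      refine hasSum_of_forall_eq h1.1 fun l => ?_
      rw [hr, ← Complex.ofReal_pow, ← Complex.ofReal_mul, Complex.ofReal_re]
    have hq := (differentiable_eval q).continuous.comp (hΓ.continuous k)
    have hpu := (differentiable_potential d u).continuous.comp (hΓ.continuous k)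
    have hpτ := (differentiable_potential d τ).continuous
    have hmeas : AEStronglyMeasurable (fun s => Complex.exp (-potential d u (Γ k s)) *
        q.eval (Γ k s) * deriv (Γ k) s) volume :=
      (Continuous.aestronglyMeasurable (hpu.neg.cexp.mul hq)).mul
        (measurable_deriv _).aestronglyMeasurable
    refine hasSum_integral_of_dominated_convergence (fun l s => r l * ‖Γ k s‖ ^ l *
        ‖Complex.exp (-potential d u (Γ k s)) * q.eval (Γ k s) * deriv (Γ k) s‖)
      (fun l => ?_) (fun l => Eventually.of_forall fun s => ?_)
      (Eventually.of_forall fun s => (hsum s).summable) ?_ (Eventually.of_forall fun s => ?_)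
    · have h1 := (hmeas.mul ((hΓ.continuous k).pow l).aestronglyMeasurable).const_mul
        (expCoeff d (-t) l)
      refine h1.congr (Eventually.of_forall fun s => ?_)
      simp only [Pi.mul_apply, Pi.pow_apply, Polynomial.eval_mul, Polynomial.eval_pow,
        Polynomial.eval_X]
      ring
    · rw [Polynomial.eval_mul, Polynomial.eval_pow, Polynomial.eval_X,
        show Complex.exp (-potential d u (Γ k s)) * (Γ k s ^ l * q.eval (Γ k s)) *
          deriv (Γ k) s = Γ k s ^ l * (Complex.exp (-potential d u (Γ k s)) * q.eval (Γ k s) *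
          deriv (Γ k) s) by ring, norm_mul, norm_mul (Γ k s ^ l), norm_pow, ← mul_assoc]
      gcongr
      exact hr' l
    · simp_rw [fun s => (hsum s).tsum_eq]
      have h1 := integrable_growth_eval hΓ u τ k (by simpa [hτ] using (ht k).1)
        (by simpa [hτ] using (ht k).2) q
      refine h1.mono ?_ (Eventually.of_forall fun s => ?_)
      · refine (Continuous.aestronglyMeasurable ?_).mul hmeas.norm
        have hn : Continuous fun s => ((‖Γ k s‖ : ℝ) : ℂ) :=
          Complex.continuous_ofReal.comp (hΓ.continuous k).norm
        exact Complex.continuous_re.comp (hpτ.comp hn).cexp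
      · rw [norm_mul, norm_norm, growth, Real.exp_add]
        have h2 : ‖(Complex.exp (potential d τ (‖Γ k s‖ : ℂ))).re‖ ≤
            Real.exp (potential d τ (‖Γ k s‖ : ℂ)).re := by
          rw [← Complex.norm_exp]
          exact Complex.abs_re_le_norm _
        simp only [norm_mul, Complex.norm_exp, Complex.neg_re, Complex.norm_real,
          Real.norm_of_nonneg (Real.exp_pos _).le]
        calc _ ≤ Real.exp (potential d τ (‖Γ k s‖ : ℂ)).re *
              (Real.exp (-(potential d u (Γ k s)).re) * ‖q.eval (Γ k s)‖ * ‖deriv (Γ k) s‖) := by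
              gcongr
          _ = _ := by ring
    · have h1 := (hasSum_expCoeff d (-t) (Γ k s)).mul_right
        (Complex.exp (-potential d u (Γ k s)) * q.eval (Γ k s) * deriv (Γ k) s)
      have h2 : Complex.exp (-potential d (u + t) (Γ k s)) * q.eval (Γ k s) * deriv (Γ k) s =
          Complex.exp (potential d (-t) (Γ k s)) *
            (Complex.exp (-potential d u (Γ k s)) * q.eval (Γ k s) * deriv (Γ k) s) := by
        rw [potential_add, potential_neg, neg_add, Complex.exp_add]
        ring
      rw [h2]
      refine hasSum_of_forall_eq h1 fun l => ?_
      rw [Polynomial.eval_mul, Polynomial.eval_pow, Polynomial.eval_X]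
      ring
  have h1 := hasSum_sum (s := Finset.univ) fun k _ => (hterm k).mul_left (ϰ k)
  refine hasSum_of_forall_eq h1 fun l => ?_
  simp only [momentFunctional, contourIntegral, Finset.mul_sum]
  refine Finset.sum_congr rfl fun k _ => ?_
  rw [integral_const_mul]
  ring

end Contours

/-! ### The partition function as a Hankel determinant -/

/-- The `n × n` Hankel matrix of the moments of `L`. -/
def hankel (L : ℂ[X] → ℂ) (n : ℕ) : Matrix (Fin n) (Fin n) ℂ :=
  Matrix.of fun i j => L (X ^ ((i : ℕ) + j))

/-- For fixed ρ, the sum over π is sign(ρ) times the determinant of M with its columns permuted by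
ρ, which is det M. The n! choices of ρ contribute equally. -/
lemma sum_perm_sum_perm_eq_factorial_mul_det {n : ℕ} (M : Matrix (Fin n) (Fin n) ℂ) :
    ∑ ρ : Equiv.Perm (Fin n), ∑ π : Equiv.Perm (Fin n),
      ((Equiv.Perm.sign π : ℤ) : ℂ) * ((Equiv.Perm.sign ρ : ℤ) : ℂ) * ∏ j, M (π j) (ρ j) =
    n.factorial * M.det := by
  have h1 : ∀ ρ : Equiv.Perm (Fin n), ∑ π : Equiv.Perm (Fin n),
      ((Equiv.Perm.sign π : ℤ) : ℂ) * ((Equiv.Perm.sign ρ : ℤ) : ℂ) * ∏ j, M (π j) (ρ j) =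
        M.det := by
    intro ρ
    have h2 := Matrix.det_permute' ρ M
    rw [Matrix.det_apply'] at h2
    have h3 : ((Equiv.Perm.sign ρ : ℤ) : ℂ) * ((Equiv.Perm.sign ρ : ℤ) : ℂ) = 1 := by
      rw [← Int.cast_mul, ← Units.val_mul, Int.units_mul_self]
      simp
    calc _ = ((Equiv.Perm.sign ρ : ℤ) : ℂ) * ∑ π : Equiv.Perm (Fin n),
          ((Equiv.Perm.sign π : ℤ) : ℂ) * ∏ j, M.submatrix id ρ (π j) j := by
          rw [Finset.mul_sum]
          exact Finset.sum_congr rfl fun π _ => by simp only [Matrix.submatrix_apply, id]; ring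
      _ = M.det := by rw [h2, ← mul_assoc, h3, one_mul]
  rw [Finset.sum_congr rfl fun ρ _ => h1 ρ]
  simp [Fintype.card_perm]

/-- Two copies of the Vandermonde determinant are expanded independently, leaving products of
functions of single variables. Squaring removes the sign between x_i - x_j and x_j - x_i. -/
lemma sq_prod_sub_eq {n : ℕ} (x : Fin n → ℂ) :
    (∏ i : Fin n, ∏ j ∈ Finset.Ioi i, (x i - x j)) ^ 2 =
      ∑ ρ : Equiv.Perm (Fin n), ∑ π : Equiv.Perm (Fin n),
        ((Equiv.Perm.sign π : ℤ) : ℂ) * ((Equiv.Perm.sign ρ : ℤ) : ℂ) *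
          ∏ j, x j ^ ((π j : ℕ) + ρ j) := by
  have h1 : (∏ i : Fin n, ∏ j ∈ Finset.Ioi i, (x i - x j)) ^ 2 =
      (Matrix.vandermonde x).transpose.det ^ 2 := by
    rw [Matrix.det_transpose, Matrix.det_vandermonde]
    simp only [← Finset.prod_pow]
    exact Finset.prod_congr rfl fun i _ => Finset.prod_congr rfl fun j _ => by ring
  rw [h1, sq, Matrix.det_apply', Finset.sum_mul_sum, Finset.sum_comm]
  refine Finset.sum_congr rfl fun ρ _ => Finset.sum_congr rfl fun π _ => ?_
  simp only [Matrix.transpose_apply, Matrix.vandermonde_apply, pow_add, Finset.prod_mul_distrib]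
  ring

section Partition

variable {d : ℕ} {Γ : Fin d → ℝ → ℂ} {v : ℕ → ℂ}

lemma partitionIntegrand_eq (n : ℕ) (σ : Fin n → Fin d) :
    partitionIntegrand n v Γ σ = fun s => ∑ ρ : Equiv.Perm (Fin n), ∑ π : Equiv.Perm (Fin n),
        ((Equiv.Perm.sign π : ℤ) : ℂ) * ((Equiv.Perm.sign ρ : ℤ) : ℂ) *
          ∏ j, (Complex.exp (-potential d v (Γ (σ j) (s j))) *
            (X ^ ((π j : ℕ) + ρ j) : ℂ[X]).eval (Γ (σ j) (s j)) * deriv (Γ (σ j)) (s j)) := by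
  funext s
  rw [partitionIntegrand, sq_prod_sub_eq fun j => Γ (σ j) (s j), ← Finset.sum_neg_distrib,
    Complex.exp_sum, Finset.sum_mul, Finset.sum_mul]
  refine Finset.sum_congr rfl fun ρ _ => ?_
  rw [Finset.sum_mul, Finset.sum_mul]
  refine Finset.sum_congr rfl fun π _ => ?_
  simp only [Finset.prod_mul_distrib, Polynomial.eval_pow, Polynomial.eval_X]
  ring

variable (hv : ∀ q : ℂ[X], ContourIntegrable Γ fun x => Complex.exp (-potential d v x) * q.eval x)

include hv in
lemma integrable_partitionIntegrand (n : ℕ) (σ : Fin n → Fin d) :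
    Integrable (partitionIntegrand n v Γ σ) := by
  rw [partitionIntegrand_eq]
  refine integrable_finsetSum _ fun ρ _ => integrable_finsetSum _ fun π _ => ?_
  exact (Integrable.fintype_prod fun j => hv (X ^ ((π j : ℕ) + ρ j)) (σ j)).const_mul _

include hv in
lemma partitionFunction_eq_det_hankel (n : ℕ) (ϰ : Fin d → ℂ) :
    partitionFunction n v ϰ Γ =
      n.factorial * (hankel (momentFunctional v ϰ Γ) n).det := by
  have hint : ∀ (σ : Fin n → Fin d) (ρ π : Equiv.Perm (Fin n)), Integrable fun s : Fin n → ℝ =>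
      ((Equiv.Perm.sign π : ℤ) : ℂ) * ((Equiv.Perm.sign ρ : ℤ) : ℂ) *
          ∏ j, (Complex.exp (-potential d v (Γ (σ j) (s j))) *
            (X ^ ((π j : ℕ) + ρ j) : ℂ[X]).eval (Γ (σ j) (s j)) * deriv (Γ (σ j)) (s j)) :=
    fun σ ρ π => (Integrable.fintype_prod fun j => hv (X ^ ((π j : ℕ) + ρ j)) (σ j)).const_mul _
  have h1 : ∀ σ : Fin n → Fin d, ∫ s : Fin n → ℝ, partitionIntegrand n v Γ σ s =
      ∑ ρ : Equiv.Perm (Fin n), ∑ π : Equiv.Perm (Fin n),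
        ((Equiv.Perm.sign π : ℤ) : ℂ) * ((Equiv.Perm.sign ρ : ℤ) : ℂ) *
          ∏ j, ∫ s : ℝ, Complex.exp (-potential d v (Γ (σ j) s)) *
            (X ^ ((π j : ℕ) + ρ j) : ℂ[X]).eval (Γ (σ j) s) * deriv (Γ (σ j)) s := by
    intro σ
    rw [partitionIntegrand_eq, integral_finsetSum _ fun ρ _ =>
      integrable_finsetSum _ fun π _ => hint σ ρ π]
    refine Finset.sum_congr rfl fun ρ _ => ?_
    rw [integral_finsetSum _ fun π _ => hint σ ρ π]
    refine Finset.sum_congr rfl fun π _ => ?_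
    rw [integral_const_mul]
    congr 1
    exact integral_fintype_prod_volume_eq_prod fun j s =>
      Complex.exp (-potential d v (Γ (σ j) s)) *
        (X ^ ((π j : ℕ) + ρ j) : ℂ[X]).eval (Γ (σ j) s) * deriv (Γ (σ j)) s
  rw [partitionFunction, ← sum_perm_sum_perm_eq_factorial_mul_det]
  simp only [h1, Finset.mul_sum]
  rw [Finset.sum_comm]
  refine Finset.sum_congr rfl fun ρ _ => ?_
  rw [Finset.sum_comm]
  refine Finset.sum_congr rfl fun π _ => ?_
  simp only [hankel, Matrix.of_apply, momentFunctional, contourIntegral]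
  -- Each moment is itself a sum over the d contours. Expanding their product recovers the sum over
  -- assignments σ of contours to variables.
  rw [Finset.prod_univ_sum, Fintype.piFinset_univ, Finset.mul_sum]
  refine Finset.sum_congr rfl fun σ _ => ?_
  rw [Finset.prod_mul_distrib]
  ring

end Partition

/-! ### Changes of basis by triangular matrices -/

lemma sum_range_coeff_smul_X_pow {f : ℂ[X]} {N : ℕ} (hf : f.degree < N) :
    f = ∑ k ∈ Finset.range N, f.coeff k • (X : ℂ[X]) ^ k := by
  ext i
  simp only [Polynomial.finsetSum_coeff, Polynomial.coeff_smul, Polynomial.coeff_X_pow,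
    smul_eq_mul, mul_ite, mul_one, mul_zero, Finset.sum_ite_eq, Finset.mem_range]
  split_ifs with h
  · rfl
  · exact Polynomial.coeff_eq_zero_of_degree_lt (hf.trans_le (by exact_mod_cast not_lt.mp h))

lemma degree_lt_of_natDegree_lt {f : ℂ[X]} {N : ℕ} (hf : f.natDegree < N) : f.degree < N :=
  Polynomial.degree_le_natDegree.trans_lt (by exact_mod_cast hf)

/-- The matrix of coefficients of the first `n` polynomials of a sequence. -/
def coeffMatrix (n : ℕ) (p : ℕ → ℂ[X]) : Matrix (Fin n) (Fin n) ℂ :=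
  Matrix.of fun k j => (p j).coeff k

lemma det_upper_eq_one {N : ℕ} {M : Matrix (Fin N) (Fin N) ℂ} (h0 : ∀ i j, j < i → M i j = 0)
    (h1 : ∀ i, M i i = 1) : M.det = 1 := by
  rw [Matrix.det_of_isUpperTriangular fun i j hij => h0 i j hij]
  simp [h1]

lemma det_lower_eq_one {N : ℕ} {M : Matrix (Fin N) (Fin N) ℂ} (h0 : ∀ i j, i < j → M i j = 0)
    (h1 : ∀ i, M i i = 1) : M.det = 1 := by
  rw [← Matrix.det_transpose]
  exact det_upper_eq_one (fun i j hij => h0 j i hij) h1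

lemma det_coeffMatrix {p : ℕ → ℂ[X]} (hm : ∀ j, (p j).Monic) (hd : ∀ j, (p j).natDegree = j)
    (n : ℕ) : (coeffMatrix n p).det = 1 := by
  refine det_upper_eq_one (fun i j hij => ?_) fun i => ?_
  · exact Polynomial.coeff_eq_zero_of_natDegree_lt (by rw [hd]; exact hij)
  · have := (hm i).coeff_natDegree
    rwa [hd] at this

/-- Two different families are allowed because the p_j are later paired with themselves, with
monomials, and with the low-degree parts of e^ξ p_j. -/
lemma moment_matrix_eq (L : ℂ[X] →ₗ[ℂ] ℂ) (n : ℕ) {p r : ℕ → ℂ[X]}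
    (hp : ∀ j < n, (p j).degree < n) (hr : ∀ j < n, (r j).degree < n) :
    (Matrix.of fun i j : Fin n => L (p i * r j)) =
      (coeffMatrix n p).transpose * hankel L n * coeffMatrix n r := by
  ext i j
  simp only [Matrix.of_apply, Matrix.mul_apply, Matrix.transpose_apply, coeffMatrix, hankel]
  conv_lhs => rw [sum_range_coeff_smul_X_pow (hp i i.2), sum_range_coeff_smul_X_pow (hr j j.2)]
  rw [Finset.sum_range, Finset.sum_range, Finset.mul_sum, map_sum]
  refine Finset.sum_congr rfl fun k _ => ?_
  rw [Finset.sum_mul, map_sum, Finset.sum_mul]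
  refine Finset.sum_congr rfl fun l _ => ?_
  rw [smul_mul_smul_comm, map_smul, ← pow_add, smul_eq_mul]
  ring

/-! ### Orthogonal polynomials of a linear functional -/

/-- `p` is the sequence of monic orthogonal polynomials of `L`, with norms `h`. -/
structure IsOrthogonal (L : ℂ[X] →ₗ[ℂ] ℂ) (p : ℕ → ℂ[X]) (h : ℕ → ℂ) : Prop where
  monic : ∀ j, (p j).Monic
  natDegree_eq : ∀ j, (p j).natDegree = j
  h_ne_zero : ∀ j, h j ≠ 0
  orthogonal : ∀ i j, L (p i * p j) = if i = j then h i else 0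

/-- The orthogonal projection to the polynomials of degree less than `n`. -/
def orthProj (L : ℂ[X] →ₗ[ℂ] ℂ) (p : ℕ → ℂ[X]) (h : ℕ → ℂ) (n : ℕ) : ℂ[X] →ₗ[ℂ] ℂ[X] :=
  ∑ j ∈ Finset.range n, ((h j)⁻¹ • L ∘ₗ LinearMap.mulRight ℂ (p j)).smulRight (p j)

lemma orthProj_apply (L : ℂ[X] →ₗ[ℂ] ℂ) (p : ℕ → ℂ[X]) (h : ℕ → ℂ) (n : ℕ) (f : ℂ[X]) :
    orthProj L p h n f = ∑ j ∈ Finset.range n, ((h j)⁻¹ * L (f * p j)) • p j := by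
  simp [orthProj]

/-- The matrix of the map `H_+ → H_n` whose graph is `span {p_j}_{j ≥ n}`. -/
def graphCoeff (L : ℂ[X] →ₗ[ℂ] ℂ) (p : ℕ → ℂ[X]) (h : ℕ → ℂ) (n a l : ℕ) : ℂ :=
  -(orthProj L p h n (X ^ (n + l))).coeff a

namespace IsOrthogonal

variable {L : ℂ[X] →ₗ[ℂ] ℂ} {p : ℕ → ℂ[X]} {h : ℕ → ℂ} (H : IsOrthogonal L p h)

include H

/-- The orthogonal polynomials as a polynomial sequence. -/
lemma exists_sequence : ∃ S : Polynomial.Sequence ℂ, ∀ j, S j = p j :=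
  ⟨⟨p, fun j => by rw [Polynomial.degree_eq_natDegree (H.monic j).ne_zero, H.natDegree_eq]⟩,
    fun _ => rfl⟩

lemma degree_lt {j n : ℕ} (hj : j < n) : (p j).degree < n :=
  degree_lt_of_natDegree_lt (by rw [H.natDegree_eq]; exact hj)

lemma degree_orthProj_lt (n : ℕ) (f : ℂ[X]) : (orthProj L p h n f).degree < n := by
  rw [orthProj_apply, ← Polynomial.mem_degreeLT]
  refine Submodule.sum_mem _ fun j hj => Submodule.smul_mem _ _ ?_
  exact Polynomial.mem_degreeLT.mpr (H.degree_lt (Finset.mem_range.mp hj))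

lemma orthProj_of_degree_lt {n : ℕ} {f : ℂ[X]} (hf : f.degree < n) :
    orthProj L p h n f = f := by
  obtain ⟨S, hS⟩ := H.exists_sequence
  have h1 := S.span_degreeLT (m := n) fun i _ => by
    rw [hS, (H.monic i).leadingCoeff]
    exact isUnit_one
  have h2 : Set.EqOn (orthProj L p h n) (LinearMap.id : ℂ[X] →ₗ[ℂ] ℂ[X]) (S '' Set.Iio n) := by
    rintro _ ⟨i, hi, rfl⟩
    simp only [hS, orthProj_apply, LinearMap.id_apply]
    rw [Finset.sum_eq_single_of_mem i (Finset.mem_range.mpr hi)]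
    · rw [H.orthogonal, if_pos rfl, inv_mul_cancel₀ (H.h_ne_zero i), one_smul]
    · intro j _ hj
      rw [H.orthogonal, if_neg (Ne.symm hj), mul_zero, zero_smul]
  have h3 := LinearMap.eqOn_span h2
  rw [h1] at h3
  exact h3 (Polynomial.mem_degreeLT.mpr hf)

/-- For the converse, f equals its own projection for a cutoff n + M exceeding its degree. The first
n terms of that expansion vanish by assumption, and the rest are multiples of p_j with j ≥ n. -/
lemma mem_initialSubspace_iff (n : ℕ) (f : ℂ[X]) :
    f ∈ initialSubspace n p ↔ orthProj L p h n f = 0 := by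
  constructor
  · intro hf
    have h1 : initialSubspace n p ≤ LinearMap.ker (orthProj L p h n) := by
      refine Submodule.span_le.mpr ?_
      rintro _ ⟨i, hi, rfl⟩
      simp only [Set.mem_ofPred_eq] at hi
      simp only [SetLike.mem_coe, LinearMap.mem_ker, orthProj_apply]
      refine Finset.sum_eq_zero fun j hj => ?_
      have := Finset.mem_range.mp hj
      rw [H.orthogonal, if_neg (by omega), mul_zero, zero_smul]
    exact h1 hf
  · intro hf
    have h1 : f.degree < (n + (f.natDegree + 1) : ℕ) := degree_lt_of_natDegree_lt (by omega)
    rw [← H.orthProj_of_degree_lt h1, orthProj_apply, Finset.sum_range_add, ← orthProj_apply, hf,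
      zero_add]
    refine Submodule.sum_mem _ fun j _ => Submodule.smul_mem _ _ (Submodule.subset_span ?_)
    exact ⟨n + j, by simp, rfl⟩

/-- The projection annihilates f and fixes monomials of degree < n, so the low coefficients of f are
determined linearly by the high ones: `initialSubspace n p` is a graph over H_+. -/
lemma coeff_eq_sum_graphCoeff {n N : ℕ} {f : ℂ[X]} (hf : f ∈ initialSubspace n p)
    (hd : f.natDegree < n + N) (a : ℕ) (ha : a < n) :
    f.coeff a = ∑ l ∈ Finset.range N, graphCoeff L p h n a l * f.coeff (n + l) := by
  have h1 := (H.mem_initialSubspace_iff n f).mp hf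
  rw [sum_range_coeff_smul_X_pow (degree_lt_of_natDegree_lt hd), map_sum,
    Finset.sum_range_add] at h1
  have h2 := congrArg (fun q : ℂ[X] => q.coeff a) h1
  simp only [map_smul, Polynomial.coeff_add, Polynomial.finsetSum_coeff, Polynomial.coeff_smul,
    Polynomial.coeff_zero, smul_eq_mul] at h2
  have h3 : ∑ k ∈ Finset.range n, f.coeff k * (orthProj L p h n (X ^ k)).coeff a = f.coeff a := by
    rw [Finset.sum_eq_single_of_mem a (Finset.mem_range.mpr ha)]
    · rw [H.orthProj_of_degree_lt (by simpa using ha)]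
      simp
    · intro k hk hne
      rw [H.orthProj_of_degree_lt (by simpa using hk), Polynomial.coeff_X_pow, if_neg hne.symm,
        mul_zero]
  rw [h3] at h2
  rw [eq_neg_of_add_eq_zero_left h2, ← Finset.sum_neg_distrib]
  exact Finset.sum_congr rfl fun l _ => by rw [graphCoeff]; ring

lemma det_hankel (n : ℕ) : (hankel L n).det = ∏ j ∈ Finset.range n, h j := by
  have h1 := congrArg Matrix.det (moment_matrix_eq L n (p := p) (r := p)
    (fun j hj => H.degree_lt hj) (fun j hj => H.degree_lt hj))
  rw [Matrix.det_mul, Matrix.det_mul, Matrix.det_transpose,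
    det_coeffMatrix H.monic H.natDegree_eq, one_mul, mul_one] at h1
  have h2 : (Matrix.of fun i j : Fin n => L (p i * p j)) =
      Matrix.diagonal fun j : Fin n => h j := by
    ext i j
    simp [H.orthogonal, Matrix.diagonal_apply, Fin.val_inj]
  rw [← h1, h2, Matrix.det_diagonal, Finset.prod_range]

lemma isAdmissibleFrame (n : ℕ) :
    IsAdmissibleFrame n (initialSubspace n p) fun j => p (n + j) := by
  obtain ⟨S, hS⟩ := H.exists_sequence
  refine ⟨?_, ?_, fun j => H.monic _, fun j => H.natDegree_eq _⟩
  · have h1 := S.linearIndependent.comp (fun j => n + j) (add_right_injective n)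
    simpa [Function.comp_def, hS] using h1
  · rw [initialSubspace]
    congr 1
    ext f
    constructor
    · rintro ⟨j, rfl⟩
      exact ⟨n + j, by simp, rfl⟩
    · rintro ⟨j, hj, rfl⟩
      exact ⟨j - n, by simp only [Set.mem_ofPred_eq] at hj; simp [Nat.add_sub_cancel' hj]⟩

/-- An element with zero projection has degree < n, so it is both fixed and killed by `orthProj`. A
preimage of g is g minus its orthogonal projection. -/
lemma projOn_bijective (n : ℕ) : Function.Bijective (projOn n (initialSubspace n p)) := by
  have hlow : ∀ f : ℂ[X],
      (∑ j ∈ Finset.range n, monomial j (f.coeff j)).degree < n := fun f => by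
    rw [← Polynomial.mem_degreeLT]
    refine Submodule.sum_mem _ fun j hj => Polynomial.mem_degreeLT.mpr ?_
    exact (Polynomial.degree_monomial_le _ _).trans_lt (by exact_mod_cast Finset.mem_range.mp hj)
  constructor
  · rw [← LinearMap.ker_eq_bot, LinearMap.ker_eq_bot']
    rintro ⟨f, hf⟩ h0
    have h1 : f - ∑ j ∈ Finset.range n, monomial j (f.coeff j) = 0 := congrArg Subtype.val h0
    have h2 : f.degree < n := by
      rw [sub_eq_zero.mp h1]
      exact hlow f
    have h3 := (H.mem_initialSubspace_iff n f).mp hf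
    rw [H.orthProj_of_degree_lt h2] at h3
    exact Subtype.ext h3
  · rintro ⟨g, hg⟩
    refine ⟨⟨g - orthProj L p h n g, ?_⟩, ?_⟩
    · rw [H.mem_initialSubspace_iff n, map_sub,
        H.orthProj_of_degree_lt (H.degree_orthProj_lt n g), sub_self]
    · ext k
      have hk : (orthProj L p h n g).coeff k =
          if k < n then (orthProj L p h n g).coeff k else 0 := by
        split_ifs with hk
        · rfl
        · exact Polynomial.coeff_eq_zero_of_degree_lt
            ((H.degree_orthProj_lt n g).trans_le (by exact_mod_cast not_lt.mp hk))
      have hg' : k < n → g.coeff k = 0 := fun hk => hg k hk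
      simp only [projOn, projPlus, LinearMap.comp_apply, Submodule.subtype_apply,
        LinearMap.coe_mk, AddHom.coe_mk, Polynomial.coeff_sub, Polynomial.finsetSum_coeff,
        Polynomial.coeff_monomial, Finset.sum_ite_eq', Finset.mem_range]
      split_ifs at hk ⊢ with h1
      · simp [hg' h1]
      · simp [hk]

lemma inGrassmannian (n : ℕ) : InGrassmannian n (initialSubspace n p) := by
  obtain ⟨h1, h2⟩ := H.projOn_bijective n
  rw [InGrassmannian, LinearMap.ker_eq_bot.mpr h1, LinearMap.range_eq_top.mpr h2]
  exact ⟨inferInstance, inferInstance⟩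

end IsOrthogonal

/-! ### Fredholm determinants of operators of finite rank -/

lemma det_id_sub_comp_comm {V W : Type*} [AddCommGroup V] [Module ℂ V] [Module.Finite ℂ V]
    [AddCommGroup W] [Module ℂ W] [Module.Finite ℂ W] (a : W →ₗ[ℂ] V) (b : V →ₗ[ℂ] W) :
    LinearMap.det (LinearMap.id - a ∘ₗ b) = LinearMap.det (LinearMap.id - b ∘ₗ a) := by
  let bV := Module.finBasis ℂ V
  let bW := Module.finBasis ℂ W
  rw [← LinearMap.det_toMatrix bV, ← LinearMap.det_toMatrix bW, map_sub, map_sub,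
    LinearMap.toMatrix_id, LinearMap.toMatrix_id, LinearMap.toMatrix_comp bV bW bV,
    LinearMap.toMatrix_comp bW bV bW, Matrix.det_one_sub_mul_comm]

/-- Since E may be infinite-dimensional, det(1 - XY) = det(1 - YX) cannot be used on E directly. It
is used twice between finite-dimensional spaces: from the range of Φ∘Λ to the range of Λ, then from
there to F. -/
lemma fredholmDet_comp {E F : Type*} [AddCommGroup E] [Module ℂ E] [AddCommGroup F] [Module ℂ F]
    [Module.Finite ℂ F] (Φ : F →ₗ[ℂ] E) (Λ : E →ₗ[ℂ] F) :
    fredholmDet (Φ ∘ₗ Λ) = LinearMap.det (LinearMap.id - Λ ∘ₗ Φ) := by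
  have hfin : Module.Finite ℂ (LinearMap.range (Φ ∘ₗ Λ)) :=
    Module.Finite.of_injective (Submodule.inclusion (LinearMap.range_comp_le_range Λ Φ))
      (Submodule.inclusion_injective _)
  let Ψ : LinearMap.range Λ →ₗ[ℂ] LinearMap.range (Φ ∘ₗ Λ) :=
    (Φ ∘ₗ (LinearMap.range Λ).subtype).codRestrict _ (by
      rintro ⟨_, e, rfl⟩
      exact ⟨e, rfl⟩)
  have h1 : (Φ ∘ₗ Λ).rangeRestrict = Ψ ∘ₗ Λ.rangeRestrict := by
    ext e
    rfl
  have h2 : (LinearMap.range (Φ ∘ₗ Λ)).subtype ∘ₗ Ψ = Φ ∘ₗ (LinearMap.range Λ).subtype := rfl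
  have h3 : (LinearMap.range Λ).subtype ∘ₗ Λ.rangeRestrict = Λ := rfl
  rw [fredholmDet, h1, LinearMap.comp_assoc, det_id_sub_comp_comm, LinearMap.comp_assoc, h2,
    ← LinearMap.comp_assoc, det_id_sub_comp_comm, ← LinearMap.comp_assoc, h3]

/-- The operator `f ↦ ∑ ℓ_j(f) φ_j`. -/
lemma exists_finiteRank_operator {E : Type*} [AddCommGroup E] [Module ℂ E] {n : ℕ} (φ : Fin n → E)
    (ℓ : Fin n → E →ₗ[ℂ] ℂ) :
    ∃ K : E →ₗ[ℂ] E, (∀ f, K f = ∑ j, ℓ j f • φ j) ∧ Module.Finite ℂ (LinearMap.range K) ∧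
      Module.finrank ℂ (LinearMap.range K) ≤ n ∧
      fredholmDet K = (1 - Matrix.of fun i j => ℓ i (φ j)).det := by
  have hle : LinearMap.range (Fintype.linearCombination ℂ φ ∘ₗ LinearMap.pi ℓ) ≤
      LinearMap.range (Fintype.linearCombination ℂ φ) := LinearMap.range_comp_le_range _ _
  refine ⟨Fintype.linearCombination ℂ φ ∘ₗ LinearMap.pi ℓ, fun f => ?_, ?_, ?_, ?_⟩
  · simp [Fintype.linearCombination_apply]
  · exact Module.Finite.of_injective (Submodule.inclusion hle) (Submodule.inclusion_injective _)
  · refine (Submodule.finrank_mono hle).trans ((LinearMap.finrank_range_le _).trans ?_)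
    simp
  · rw [fredholmDet_comp, ← LinearMap.det_toMatrix', map_sub, LinearMap.toMatrix'_id]
    congr 2
    ext i j
    simp [LinearMap.toMatrix'_apply]

/-! ### Inverses of triangular matrices -/

/-- The `N × N` truncation of an infinite matrix. -/
def trunc (N : ℕ) (M : Matrix ℕ ℕ ℂ) : Matrix (Fin N) (Fin N) ℂ :=
  M.submatrix (fun i : Fin N => (i : ℕ)) (fun j : Fin N => (j : ℕ))

lemma triInv_apply (M : Matrix ℕ ℕ ℂ) {i j N : ℕ} (hN : max i j + 1 = N) (hi : i < N)
    (hj : j < N) : triInv M i j = (trunc N M)⁻¹ ⟨i, hi⟩ ⟨j, hj⟩ := by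
  subst hN
  rfl

lemma shiftCoeff_matrix_mul (d : ℕ) (t : ℕ → ℂ) (N : ℕ) :
    (Matrix.of fun i j : Fin N => shiftCoeff d (-t) i j) *
      (Matrix.of fun i j : Fin N => shiftCoeff d t i j) = 1 := by
  ext a b
  simp only [Matrix.mul_apply, Matrix.of_apply]
  rw [← Finset.sum_range fun l => shiftCoeff d (-t) a l * shiftCoeff d t l b,
    sum_shiftCoeff_neg_mul _ _ _ _ _ a.2, Matrix.one_apply]
  simp [Fin.ext_iff]

/-- The matrix of multiplication by e^ξ is Toeplitz, so its lower right block is the same matrix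
again, with inverse the matrix of e^{-ξ}. -/
lemma triInv_plusBlock_flowMatrix (d n : ℕ) (t : ℕ → ℂ) (i j : ℕ) :
    triInv (plusBlock n (flowMatrix d t)) i j = shiftCoeff d (-t) i j := by
  rw [triInv_apply _ rfl (by omega) (by omega),
    Matrix.inv_eq_left_inv (B := trunc _ (Matrix.of (shiftCoeff d (-t))))]
  · rfl
  · have h1 : trunc (max i j + 1) (plusBlock n (flowMatrix d t)) =
        Matrix.of fun i j : Fin _ => shiftCoeff d t i j := by
      ext a b
      simp only [trunc, Matrix.submatrix_apply, Matrix.of_apply, plusBlock, flowMatrix_apply,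
        shiftCoeff_add]
    rw [h1]
    exact shiftCoeff_matrix_mul d t _

/-- The columns p_{n+m} lie on the graph of G, so W_{n+} = G W_+, and W_+ is unit triangular. -/
lemma graphMatrix_eq {L : ℂ[X] →ₗ[ℂ] ℂ} {p : ℕ → ℂ[X]} {h : ℕ → ℂ} (H : IsOrthogonal L p h)
    (n a l : ℕ) (ha : a < n) : graphMatrix n p a l = graphCoeff L p h n a l := by
  set W := trunc (l + 1) (plusBlock n (polyMatrix p)) with hW
  have hdet : W.det = 1 := by
    refine det_upper_eq_one (fun i j hij => ?_) fun i => ?_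
    · refine Polynomial.coeff_eq_zero_of_natDegree_lt ?_
      rw [H.natDegree_eq]
      exact Nat.add_lt_add_left hij n
    · have := (H.monic (n + i)).coeff_natDegree
      rwa [H.natDegree_eq] at this
  have hinv : W * W⁻¹ = 1 := Matrix.mul_nonsing_inv _ (by rw [hdet]; exact isUnit_one)
  have h1 : ∀ m : Fin (l + 1), polyMatrix p a (n + m) =
      ∑ b : Fin (l + 1), graphCoeff L p h n a b * W b m := by
    intro m
    have h2 := (H.isAdmissibleFrame n).span_eq
    have h3 : p (n + m) ∈ initialSubspace n p := by
      rw [← h2]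
      exact Submodule.subset_span ⟨m, rfl⟩
    have h4 := H.coeff_eq_sum_graphCoeff (N := l + 1) h3
      (by rw [H.natDegree_eq]; have := m.2; omega) a ha
    rw [Finset.sum_range] at h4
    exact h4
  rw [graphMatrix, Finset.sum_range]
  -- For m ≤ l the truncation size max m l + 1 is always l + 1, so all these entries come from one
  -- inverse matrix.
  have h5 : ∀ m : Fin (l + 1), triInv (plusBlock n (polyMatrix p)) m l =
      W⁻¹ m ⟨l, by omega⟩ := fun m =>
    triInv_apply _ (by have := m.2; omega) m.2 _
  simp only [h1, h5, Finset.sum_mul]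
  rw [Finset.sum_comm]
  have h6 : ∀ b : Fin (l + 1), ∑ m : Fin (l + 1), graphCoeff L p h n a b * W b m *
      W⁻¹ m ⟨l, by omega⟩ = if b = ⟨l, by omega⟩ then graphCoeff L p h n a b else 0 := by
    intro b
    have h7 := congrFun (congrFun hinv b) ⟨l, by omega⟩
    rw [Matrix.mul_apply, Matrix.one_apply] at h7
    simp only [mul_assoc]
    rw [← Finset.mul_sum, h7, mul_ite, mul_one, mul_zero]
  rw [Finset.sum_congr rfl fun b _ => h6 b]
  simp

/-! ### The infinite determinant -/

/-- The coefficients of `∑_{j<n} h_j⁻¹ L'(x^b p_j) p_j`. -/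
def mixedCoeff (L' : ℂ[X] →ₗ[ℂ] ℂ) (p : ℕ → ℂ[X]) (h : ℕ → ℂ) (n a b : ℕ) : ℂ :=
  ∑ j ∈ Finset.range n, (h j)⁻¹ * L' (X ^ b * p j) * (p j).coeff a

namespace IsOrthogonal

variable {L : ℂ[X] →ₗ[ℂ] ℂ} {p : ℕ → ℂ[X]} {h : ℕ → ℂ} (H : IsOrthogonal L p h)

include H

/-- With P the unit triangular coefficient matrix of the p_j and 𝓗' the Hankel matrix of L', the
matrix factors as P diag(h_j⁻¹) Pᵀ 𝓗'. -/
lemma det_mixedCoeff (L' : ℂ[X] →ₗ[ℂ] ℂ) (n : ℕ) :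
    (Matrix.of fun a b : Fin n => mixedCoeff L' p h n a b).det =
      (hankel L' n).det / ∏ j ∈ Finset.range n, h j := by
  have h1 : (Matrix.of fun a b : Fin n => mixedCoeff L' p h n a b) =
      coeffMatrix n p * Matrix.diagonal (fun j : Fin n => (h j)⁻¹) *
        ((coeffMatrix n p).transpose * hankel L' n) := by
    have h2 := moment_matrix_eq L' n (p := p) (r := fun j => X ^ j)
      (fun j hj => H.degree_lt hj) (fun j hj => by simpa using hj)
    have h3 : coeffMatrix n (fun j => (X : ℂ[X]) ^ j) = 1 := by
      ext a b
      simp [coeffMatrix, Polynomial.coeff_X_pow, Matrix.one_apply, Fin.ext_iff]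
    rw [h3, mul_one] at h2
    rw [← h2]
    ext a b
    rw [Matrix.mul_apply, Matrix.of_apply, mixedCoeff, Finset.sum_range]
    refine Finset.sum_congr rfl fun j _ => ?_
    rw [Matrix.mul_diagonal, coeffMatrix, Matrix.of_apply, Matrix.of_apply, mul_comm (X ^ (b : ℕ))]
    ring
  rw [h1, Matrix.det_mul, Matrix.det_mul, Matrix.det_mul, Matrix.det_transpose,
    det_coeffMatrix H.monic H.natDegree_eq, Matrix.det_diagonal, one_mul, one_mul,
    Finset.prod_inv_distrib, Finset.prod_range, div_eq_mul_inv, mul_comm]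

variable {d : ℕ} {t : ℕ → ℂ} {L' : ℂ[X] →ₗ[ℂ] ℂ}
  (hL' : ∀ q : ℂ[X], HasSum (fun l => expCoeff d (-t) l * L (X ^ l * q)) (L' q))

include hL'

/-- Summing the coefficients of e^{-ξ} z^b against the projections of all monomials gives
`mixedCoeff`. Monomials of degree < n are fixed by the projection and account for the subtracted
entry; the others give the graph coefficients. -/
lemma hasSum_graphCoeff_mul_shiftCoeff (n a b : ℕ) (ha : a < n) :
    HasSum (fun l => -(graphCoeff L p h n a l * shiftCoeff d (-t) (n + l) b))
      (mixedCoeff L' p h n a b - shiftCoeff d (-t) a b) := by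
  have h1 : ∀ q : ℂ[X], HasSum (fun m => shiftCoeff d (-t) m b * L (X ^ m * q))
      (L' (X ^ b * q)) := by
    intro q
    rw [← hasSum_nat_add_iff' b]
    rw [Finset.sum_eq_zero fun i hi => by
      rw [shiftCoeff_of_lt _ _ (Finset.mem_range.mp hi), zero_mul], sub_zero]
    refine hasSum_of_forall_eq (hL' (X ^ b * q)) fun l => ?_
    rw [shiftCoeff, if_pos (by omega), Nat.add_sub_cancel, pow_add, mul_assoc]
  have h2 : HasSum (fun m => shiftCoeff d (-t) m b * (orthProj L p h n (X ^ m)).coeff a)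
      (mixedCoeff L' p h n a b) := by
    have h3 := hasSum_sum (s := Finset.range n) fun j _ =>
      ((h1 (p j)).mul_left (h j)⁻¹).mul_right ((p j).coeff a)
    refine hasSum_of_forall_eq h3 fun m => ?_
    rw [orthProj_apply, Polynomial.finsetSum_coeff, Finset.mul_sum]
    refine Finset.sum_congr rfl fun j _ => ?_
    rw [Polynomial.coeff_smul, smul_eq_mul]
    ring
  have h4 := (hasSum_nat_add_iff' n).mpr h2
  have h5 : ∑ m ∈ Finset.range n, shiftCoeff d (-t) m b *
      (orthProj L p h n (X ^ m)).coeff a = shiftCoeff d (-t) a b := by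
    rw [Finset.sum_eq_single_of_mem a (Finset.mem_range.mpr ha)]
    · rw [H.orthProj_of_degree_lt (by simpa using ha)]
      simp
    · intro k hk hne
      rw [H.orthProj_of_degree_lt (by simpa using hk), Polynomial.coeff_X_pow, if_neg hne.symm,
        mul_zero]
  rw [h5] at h4
  refine hasSum_of_forall_eq h4 fun l => ?_
  rw [graphCoeff, add_comm l n]
  ring

lemma isKPTau (n : ℕ) : IsKPTau d n (initialSubspace n p) t
    ((hankel L' n).det / ∏ j ∈ Finset.range n, h j) := by
  refine ⟨⟨_, H.isAdmissibleFrame n⟩, fun w hw => ?_⟩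
  set A : Matrix (Fin n) (Fin n) ℂ := Matrix.of fun a b => shiftCoeff d t a b with hA
  set A' : Matrix (Fin n) (Fin n) ℂ := Matrix.of fun a b => shiftCoeff d (-t) a b with hA'
  have hA'A : A' * A = 1 := shiftCoeff_matrix_mul d t n
  set Q : Matrix (Fin n) (Fin n) ℂ := Matrix.of fun a b => mixedCoeff L' p h n a b with hQ
  set T : ℕ → Matrix (Fin n) (Fin n) ℂ := fun N => Matrix.of fun a b =>
    ∑ l ∈ Finset.range N, -(graphCoeff L p h n a l * shiftCoeff d (-t) (n + l) b) with hT
  have hdet : ∀ N, (trunc N (flowedPlusBlock d n t w)).det = (1 + T N * A).det := by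
    intro N
    set G : Matrix (Fin n) (Fin N) ℂ := Matrix.of fun a l => graphCoeff L p h n a l with hG
    set B : Matrix (Fin N) (Fin n) ℂ := Matrix.of fun i b => shiftCoeff d t (n + i) b with hB
    set B' : Matrix (Fin N) (Fin n) ℂ := Matrix.of fun i b => shiftCoeff d (-t) (n + i) b with hB'
    set C : Matrix (Fin N) (Fin N) ℂ := Matrix.of fun i j => shiftCoeff d t i j with hC
    set D : Matrix (Fin N) (Fin N) ℂ := Matrix.of fun i j => shiftCoeff d (-t) i j with hD
    set W : Matrix (Fin N) (Fin N) ℂ := Matrix.of fun i j => (w j).coeff (n + i) with hW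
    have hWdet : W.det = 1 := by
      refine det_upper_eq_one (fun i j hij => ?_) fun i => ?_
      · refine Polynomial.coeff_eq_zero_of_natDegree_lt ?_
        rw [hw.natDegree_eq]
        exact Nat.add_lt_add_left hij n
      · have := (hw.monic i).coeff_natDegree
        rwa [hw.natDegree_eq] at this
    have hDdet : D.det = 1 := det_lower_eq_one (fun i j hij => shiftCoeff_of_lt _ _ hij)
      fun i => shiftCoeff_self _ _ _
    have hDC : D * C = 1 := shiftCoeff_matrix_mul d t N
    -- This is the lower left block of the truncated identity e^{-ξ}e^ξ = 1.
    have hDB : D * B = -(B' * A) := by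
      ext i b
      have h1 := sum_shiftCoeff_neg_mul d t (n + i) b (n + N) (by have := i.2; omega)
      rw [Finset.sum_range_add, if_neg (by have := b.2; omega)] at h1
      simp only [shiftCoeff_add] at h1
      rw [Finset.sum_range, Finset.sum_range] at h1
      rw [Matrix.neg_apply, Matrix.mul_apply, Matrix.mul_apply]
      exact eq_neg_of_add_eq_zero_right h1
    have hGB : G * B' = -T N := by
      ext a b
      simp only [Matrix.mul_apply, Matrix.neg_apply, hT, Matrix.of_apply, hG, hB']
      rw [Finset.sum_neg_distrib, neg_neg, Finset.sum_range]
    -- The truncation is exact because w_j has degree n + j < n + N. The frame enters only through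
    -- W, whose determinant is 1, hence the independence of the frame.
    have hM : trunc N (flowedPlusBlock d n t w) = (B * G + C) * W := by
      ext i j
      have hj : (w j).natDegree < n + N := by
        rw [hw.natDegree_eq]
        have := j.2
        omega
      have hwj : w j ∈ initialSubspace n p := by
        rw [← hw.span_eq]
        exact Submodule.subset_span ⟨j, rfl⟩
      have h1 := taylorCoeff_flow_eval d t (w j) (n + i) (n + N) (by have := i.2; omega)
      rw [Finset.sum_range_add] at h1
      simp only [shiftCoeff_add] at h1
      rw [add_mul, Matrix.mul_assoc, Matrix.add_apply, Matrix.mul_apply, Matrix.mul_apply]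
      have h2 : trunc N (flowedPlusBlock d n t w) i j =
        taylorCoeff (flow d t fun z => (w j).eval z) (n + i) := rfl
      rw [h2, h1, Finset.sum_range, Finset.sum_range]
      congr 1
      refine Finset.sum_congr rfl fun a _ => ?_
      rw [H.coeff_eq_sum_graphCoeff hwj hj a a.2, Finset.sum_range, Matrix.mul_apply]
      rfl
    have h1 : (B * G + C).det = (D * (B * G + C)).det := by rw [Matrix.det_mul, hDdet, one_mul]
    rw [hM, Matrix.det_mul, hWdet, mul_one, h1, mul_add, hDC, ← Matrix.mul_assoc, add_comm,
      Matrix.det_one_add_mul_comm, hDB, Matrix.mul_neg, ← Matrix.mul_assoc, hGB, Matrix.neg_mul,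
      neg_neg]
  have hlim : Tendsto T atTop (𝓝 (Q - A')) := by
    refine tendsto_pi_nhds.mpr fun a => tendsto_pi_nhds.mpr fun b => ?_
    exact (H.hasSum_graphCoeff_mul_shiftCoeff hL' n a b a.2).tendsto_sum_nat
  have hlim2 : Tendsto (fun N => (1 + T N * A).det) atTop (𝓝 (1 + (Q - A') * A).det) := by
    have hc : Continuous fun S : Matrix (Fin n) (Fin n) ℂ => (1 + S * A).det := by fun_prop
    exact (hc.tendsto _).comp hlim
  have hAdet : A.det = 1 := det_lower_eq_one (fun i j hij => shiftCoeff_of_lt _ _ hij)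
    fun i => shiftCoeff_self _ _ _
  -- In the limit 1 + (Q - A')A = QA, because A' is the inverse of A.
  rw [sub_mul, hA'A, add_sub_cancel, Matrix.det_mul, hAdet, mul_one, hQ,
    H.det_mixedCoeff L' n] at hlim2
  exact hlim2.congr fun N => (hdet N).symm

end IsOrthogonal

/-! ### The integral operator -/

/-- The part of degree less than `n` of the Taylor series of `f`. -/
def lowPart (n : ℕ) (f : ℂ → ℂ) : ℂ[X] := ∑ j ∈ Finset.range n, monomial j (taylorCoeff f j)

lemma coeff_lowPart (n : ℕ) (f : ℂ → ℂ) (k : ℕ) :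
    (lowPart n f).coeff k = if k < n then taylorCoeff f k else 0 := by
  simp [lowPart, Polynomial.finsetSum_coeff, Polynomial.coeff_monomial]

lemma degree_lowPart_lt (n : ℕ) (f : ℂ → ℂ) : (lowPart n f).degree < n :=
  (Polynomial.degree_lt_iff_coeff_zero _ _).mpr fun k hk => by
    rw [coeff_lowPart, if_neg (not_lt.mpr hk)]

lemma tailPart_eq (n : ℕ) (f : ℂ → ℂ) : tailPart n f = fun z => f z - (lowPart n f).eval z := by
  funext z
  simp [tailPart, lowPart, Polynomial.eval_finsetSum]

lemma differentiable_tailPart (n : ℕ) {f : ℂ → ℂ} (hf : Differentiable ℂ f) :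
    Differentiable ℂ (tailPart n f) := by
  rw [tailPart_eq]
  exact hf.sub (differentiable_eval _)

lemma taylorCoeff_tailPart (n : ℕ) {f : ℂ → ℂ} (hf : Differentiable ℂ f) (k : ℕ) :
    taylorCoeff (tailPart n f) k = if k < n then 0 else taylorCoeff f k := by
  rw [tailPart_eq, taylorCoeff_sub hf (differentiable_eval _), taylorCoeff_eval, coeff_lowPart]
  split_ifs <;> simp

lemma taylorCoeff_flow_eval_of_degree_lt (d : ℕ) (t : ℕ → ℂ) {q : ℂ[X]} {n : ℕ}
    (hq : q.degree < n) (i : ℕ) :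
    taylorCoeff (flow d t fun z => q.eval z) i =
      ∑ j ∈ Finset.range n, shiftCoeff d t i j * q.coeff j := by
  rw [taylorCoeff_flow_eval d t q i (n + (i + 1)) (by omega), Finset.sum_range_add,
    add_eq_left]
  refine Finset.sum_eq_zero fun j _ => ?_
  rw [(Polynomial.degree_lt_iff_coeff_zero _ _).mp hq (n + j) (by omega), mul_zero]

/-- Truncating e^ξ p_j to degree < n acts on coefficients by the block A, so the matrix is a unit
lower triangular times a unit upper triangular one. -/
lemma det_coeffMatrix_lowPart_flow {p : ℕ → ℂ[X]} (hm : ∀ j, (p j).Monic)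
    (hd : ∀ j, (p j).natDegree = j) (d n : ℕ) (t : ℕ → ℂ) :
    (coeffMatrix n fun j => lowPart n (flow d t fun z => (p j).eval z)).det = 1 := by
  have h1 : (coeffMatrix n fun j => lowPart n (flow d t fun z => (p j).eval z)) =
      (Matrix.of fun a b : Fin n => shiftCoeff d t a b) * coeffMatrix n p := by
    ext a j
    simp only [coeffMatrix, Matrix.of_apply, Matrix.mul_apply]
    rw [coeff_lowPart, if_pos a.2,
      taylorCoeff_flow_eval_of_degree_lt d t (n := n) (degree_lt_of_natDegree_lt (by
        rw [hd]; exact j.2)), Finset.sum_range]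
  rw [h1, Matrix.det_mul, det_coeffMatrix hm hd, mul_one]
  exact det_lower_eq_one (fun i j hij => shiftCoeff_of_lt _ _ hij) fun i => shiftCoeff_self _ _ _

section Operator

variable {d : ℕ} {Γ : Fin d → ℝ → ℂ}

lemma contourIntegrable_of_mem_hPlus {n : ℕ} {v : ℕ → ℂ} {f : ℂ → ℂ} (hf : f ∈ hPlus n v Γ)
    (q : ℂ[X]) :
    ContourIntegrable Γ fun x => Complex.exp (-potential d v x) * q.eval x * f x := by
  intro k
  induction q using Polynomial.induction_on' with
  | add p q hp hq =>
    refine (hp.add hq).congr (Eventually.of_forall fun s => ?_)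
    simp only [Pi.add_apply, Polynomial.eval_add]
    ring
  | monomial m a =>
    refine ((hf.2.2 k m).const_mul a).congr (Eventually.of_forall fun s => ?_)
    simp only [Polynomial.eval_monomial]
    ring

lemma X_pow_mem_hPlus {v : ℕ → ℂ}
    (hv : ∀ q : ℂ[X], ContourIntegrable Γ fun x => Complex.exp (-potential d v x) * q.eval x)
    (n k : ℕ) : (fun z : ℂ => z ^ (n + k)) ∈ hPlus n v Γ := by
  refine ⟨differentiable_pow _, fun j hj => ?_, fun i m => ?_⟩
  · rw [taylorCoeff_pow, if_neg (by omega)]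
  · refine (hv (X ^ (n + k) * X ^ m) i).congr (Eventually.of_forall fun s => ?_)
    simp only [Polynomial.eval_mul, Polynomial.eval_pow, Polynomial.eval_X]
    ring

/-- The functional `f ↦ ∫_{ϰΓ} e^{-V(x)} q(x) f(x) dx`. -/
def weightedIntegral (n : ℕ) (v : ℕ → ℂ) (ϰ : Fin d → ℂ) (Γ : Fin d → ℝ → ℂ) (q : ℂ[X]) :
    hPlus n v Γ →ₗ[ℂ] ℂ where
  toFun f := contourIntegral ϰ Γ fun x =>
    Complex.exp (-potential d v x) * q.eval x * (f : ℂ → ℂ) x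
  map_add' f g := by
    simp only [Submodule.coe_add, Pi.add_apply, mul_add]
    exact contourIntegral_add ϰ (contourIntegrable_of_mem_hPlus f.2 q)
      (contourIntegrable_of_mem_hPlus g.2 q)
  map_smul' c f := by
    simp only [Submodule.coe_smul, Pi.smul_apply, smul_eq_mul, RingHom.id_apply,
      mul_left_comm _ c]
    exact contourIntegral_const_mul ϰ c _

lemma cexp_neg_potential_add_mul (u t : ℕ → ℂ) (x : ℂ) :
    Complex.exp (-potential d (u + t) x) * Complex.exp (potential d t x) =
      Complex.exp (-potential d u x) := by
  rw [← Complex.exp_add, potential_add]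
  congr 1
  ring

lemma cexp_neg_potential_mul (u t : ℕ → ℂ) (x : ℂ) :
    Complex.exp (-potential d u x) * Complex.exp (-potential d t x) =
      Complex.exp (-potential d (u + t) x) := by
  rw [← Complex.exp_add, potential_add]
  congr 1
  ring

variable {u t : ℕ → ℂ}
  (hu : ∀ q : ℂ[X], ContourIntegrable Γ fun x => Complex.exp (-potential d u x) * q.eval x)
  (hut : ∀ q : ℂ[X],
    ContourIntegrable Γ fun x => Complex.exp (-potential d (u + t) x) * q.eval x)

include hu hut

/-- Against e^{-V_{u+t}}, the factor e^ξ q becomes e^{-V_u} q and the removed part is a polynomial.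
Both integrals converge, with no smallness condition on t. -/
lemma tailPart_flow_mem_hPlus (n : ℕ) (q : ℂ[X]) :
    tailPart n (flow d t fun z => q.eval z) ∈ hPlus n (u + t) Γ := by
  have hf := differentiable_flow (d := d) (t := t) (differentiable_eval q)
  refine ⟨differentiable_tailPart n hf, fun j hj => ?_, fun k m => ?_⟩
  · rw [taylorCoeff_tailPart n hf, if_pos hj]
  · refine ((hu (q * X ^ m) k).sub
      (hut (lowPart n (flow d t fun z => q.eval z) * X ^ m) k)).congr
      (Eventually.of_forall fun s => ?_)
    rw [tailPart_eq]
    simp only [Pi.sub_apply, Polynomial.eval_mul, Polynomial.eval_pow, Polynomial.eval_X,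
      flow, ← cexp_neg_potential_add_mul u t]
    ring

lemma weightedIntegral_tailPart_flow (n : ℕ) (ϰ : Fin d → ℂ) (p q : ℂ[X]) :
    weightedIntegral n (u + t) ϰ Γ p ⟨_, tailPart_flow_mem_hPlus hu hut n q⟩ =
      momentFunctional u ϰ Γ (p * q) - momentFunctional (u + t) ϰ Γ
        (p * lowPart n (flow d t fun z => q.eval z)) := by
  rw [momentFunctional, momentFunctional, ← contourIntegral_sub ϰ (hu _) (hut _)]
  simp only [weightedIntegral, LinearMap.coe_mk, AddHom.coe_mk, tailPart_eq]
  congr 1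
  funext x
  simp only [Polynomial.eval_mul, flow, ← cexp_neg_potential_add_mul u t]
  ring

lemma exists_integral_operator (n : ℕ) (ϰ : Fin d → ℂ) {p : ℕ → ℂ[X]} {h : ℕ → ℂ}
    (H : IsOrthogonal (momentLinear u ϰ Γ hu) p h) :
    ∃ K : hPlus n (u + t) Γ →ₗ[ℂ] hPlus n (u + t) Γ,
      (∀ f, (K f : ℂ → ℂ) = fun z => ∑ j ∈ Finset.range n,
        (h j)⁻¹ * weightedIntegral n (u + t) ϰ Γ (p j) f *
          tailPart n (flow d t fun x => (p j).eval x) z) ∧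
      (∀ (f : hPlus n (u + t) Γ) (z : ℂ), (K f : ℂ → ℂ) z = contourIntegral ϰ Γ fun w =>
        Complex.exp (-potential d u w) * kernel d n p h t z w * (f : ℂ → ℂ) w) ∧
      Module.Finite ℂ (LinearMap.range K) ∧ Module.finrank ℂ (LinearMap.range K) ≤ n ∧
      fredholmDet K =
        (hankel (momentFunctional (u + t) ϰ Γ) n).det / ∏ j ∈ Finset.range n, h j := by
  obtain ⟨K, hK, hfin, hrank, hdet⟩ := exists_finiteRank_operator
    (fun j : Fin n => (h j)⁻¹ •
      (⟨_, tailPart_flow_mem_hPlus hu hut n (p j)⟩ : hPlus n (u + t) Γ))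
    fun j : Fin n => weightedIntegral n (u + t) ϰ Γ (p j)
  have hK' : ∀ f, (K f : ℂ → ℂ) = fun z => ∑ j ∈ Finset.range n,
        (h j)⁻¹ * weightedIntegral n (u + t) ϰ Γ (p j) f *
          tailPart n (flow d t fun x => (p j).eval x) z := by
    intro f
    funext z
    rw [hK, Finset.sum_range, Submodule.coe_sum, Finset.sum_apply]
    refine Finset.sum_congr rfl fun j _ => ?_
    simp only [Submodule.coe_smul, Pi.smul_apply, smul_eq_mul]
    ring
  refine ⟨K, hK', fun f z => ?_, hfin, hrank, ?_⟩
  · have h1 := (contourIntegral_sum ϰ (Finset.range n) (f := fun j w =>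
      ((h j)⁻¹ * tailPart n (flow d t fun x => (p j).eval x) z) *
        (Complex.exp (-potential d (u + t) w) * (p j).eval w * (f : ℂ → ℂ) w))
      fun j => (contourIntegrable_of_mem_hPlus f.2 (p j)).const_mul _).2
    simp only [contourIntegral_const_mul] at h1
    rw [hK']
    refine Eq.trans ?_ (h1.symm.trans ?_)
    · refine Finset.sum_congr rfl fun j _ => ?_
      simp only [weightedIntegral, LinearMap.coe_mk, AddHom.coe_mk]
      ring
    · congr 1
      funext w
      rw [kernel, Finset.mul_sum, Finset.sum_mul]
      refine Finset.sum_congr rfl fun j _ => ?_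
      rw [← cexp_neg_potential_mul u t]
      ring
  · set r : ℕ → ℂ[X] := fun j => lowPart n (flow d t fun z => (p j).eval z) with hr
    -- The identity cancels the term h_j⁻¹ L(p_i p_j) = δ_ij, leaving only the moments L'(p_i r_j)
    -- scaled by h_j⁻¹.
    have h1 : (1 - Matrix.of fun i j : Fin n => weightedIntegral n (u + t) ϰ Γ (p i)
        ((h j)⁻¹ • (⟨_, tailPart_flow_mem_hPlus hu hut n (p j)⟩ : hPlus n (u + t) Γ))) =
        (Matrix.of fun i j : Fin n => momentLinear (u + t) ϰ Γ hut (p i * r j)) *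
          Matrix.diagonal fun j : Fin n => (h j)⁻¹ := by
      ext i j
      have h2 : momentFunctional u ϰ Γ (p i * p j) = if (i : ℕ) = j then h i else 0 :=
        H.orthogonal i j
      rw [Matrix.mul_diagonal, Matrix.sub_apply, Matrix.of_apply, Matrix.of_apply, map_smul,
        weightedIntegral_tailPart_flow hu hut, h2, Matrix.one_apply, smul_eq_mul]
      have h3 : momentLinear (u + t) ϰ Γ hut (p i * r j) =
        momentFunctional (u + t) ϰ Γ (p i * r j) := rfl
      rw [h3]
      simp only [← Fin.ext_iff]
      split_ifs with hij
      · subst hij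
        rw [mul_sub, inv_mul_cancel₀ (H.h_ne_zero _)]
        ring
      · ring
    rw [hdet, h1, moment_matrix_eq _ n (r := r) (fun j hj => H.degree_lt hj)
      (fun j _ => degree_lowPart_lt n _), Matrix.det_mul, Matrix.det_mul, Matrix.det_mul,
      Matrix.det_transpose, det_coeffMatrix H.monic H.natDegree_eq,
      det_coeffMatrix_lowPart_flow H.monic H.natDegree_eq, Matrix.det_diagonal, one_mul, mul_one,
      Finset.prod_inv_distrib, Finset.prod_range, div_eq_mul_inv]
    rfl

end Operator

end KPTau

end

/-! ### Assembly: the ratio of partition functions, the determinants and the matrix of the operator.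
-/

theorem mainTheorem5 (d n : ℕ) (u : ℕ → ℂ) (hu : u (d + 1) ≠ 0)
    (ϰ : Fin d → ℂ) (Γ : Fin d → ℝ → ℂ) (cIn cOut : Fin d → ℂ)
    (hΓ : KPTau.IsContourSystem d u Γ cIn cOut)
    (p : ℕ → Polynomial ℂ) (h : ℕ → ℂ) (hp : KPTau.IsMonicOrthogonal u ϰ Γ p h) :
    -- the initial subspace is a point of the Grassmannian, with admissible frame `p_n, p_{n+1}, …`
    KPTau.InGrassmannian n (KPTau.initialSubspace n p) ∧
    Function.Bijective (KPTau.projOn n (KPTau.initialSubspace n p)) ∧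
    KPTau.IsAdmissibleFrame n (KPTau.initialSubspace n p) (fun j => p (n + j)) ∧
    -- the initial partition function is a convergent integral and is nonzero
    (∀ σ : Fin n → Fin d, MeasureTheory.Integrable (KPTau.partitionIntegrand n u Γ σ)) ∧
    KPTau.partitionFunction n u ϰ Γ ≠ 0 ∧
    -- the Fredholm determinant, for all `t` for which `V + ∑ t_J x^J / J` grows along the contours
    ∀ t : ℕ → ℂ,
      (∀ k, 0 < ((u + t) (d + 1) * cIn k ^ (d + 1)).re ∧
        0 < ((u + t) (d + 1) * cOut k ^ (d + 1)).re) →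
      (∀ σ : Fin n → Fin d, MeasureTheory.Integrable (KPTau.partitionIntegrand n (u + t) Γ σ)) ∧
      ∃ K : KPTau.hPlus n (u + t) Γ →ₗ[ℂ] KPTau.hPlus n (u + t) Γ,
        (∀ (f : KPTau.hPlus n (u + t) Γ) (z : ℂ),
          (K f : ℂ → ℂ) z = KPTau.contourIntegral ϰ Γ (fun w =>
            Complex.exp (-KPTau.potential d u w) * KPTau.kernel d n p h t z w *
              (f : ℂ → ℂ) w)) ∧
        Module.Finite ℂ (LinearMap.range K) ∧
        Module.finrank ℂ (LinearMap.range K) ≤ n ∧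
        KPTau.fredholmDet K =
          KPTau.partitionFunction n (u + t) ϰ Γ / KPTau.partitionFunction n u ϰ Γ ∧
        -- the tau function, in the domain of convergence of the infinite determinant
        ((∀ k, ‖t (d + 1)‖ * ‖cIn k‖ ^ (d + 1) < (u (d + 1) * cIn k ^ (d + 1)).re ∧
            ‖t (d + 1)‖ * ‖cOut k‖ ^ (d + 1) < (u (d + 1) * cOut k ^ (d + 1)).re) →
          KPTau.IsKPTau d n (KPTau.initialSubspace n p) t
            (KPTau.partitionFunction n (u + t) ϰ Γ / KPTau.partitionFunction n u ϰ Γ) ∧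
          -- `K` is represented by the matrix `-B W_{n+} W_+⁻¹ C⁻¹`
          ∃ e : ℕ → KPTau.hPlus n (u + t) Γ,
            (∀ (k : ℕ) (z : ℂ), (e k : ℂ → ℂ) z = z ^ (n + k)) ∧
            ∀ i k : ℕ, HasSum (fun l : ℕ =>
              -∑ a ∈ Finset.range n, KPTau.flowMatrix d t (n + i) a *
                (KPTau.graphMatrix n p a l *
                  KPTau.triInv (KPTau.plusBlock n (KPTau.flowMatrix d t)) l k))
              (KPTau.taylorCoeff (K (e k) : ℂ → ℂ) (n + i))) := by
  have hu' := KPTau.contourIntegrable_cexp_eval hΓ fun k => hΓ.re_pos hu k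
  have H : KPTau.IsOrthogonal (KPTau.momentLinear u ϰ Γ hu') p h :=
    ⟨hp.monic, hp.natDegree_eq, hp.h_ne_zero, hp.orthogonal⟩
  have hZu : KPTau.partitionFunction n u ϰ Γ = n.factorial * ∏ j ∈ Finset.range n, h j := by
    rw [KPTau.partitionFunction_eq_det_hankel hu', ← H.det_hankel n]
    rfl
  have hn : (n.factorial : ℂ) ≠ 0 := by exact_mod_cast n.factorial_ne_zero
  refine ⟨H.inGrassmannian n, H.projOn_bijective n, H.isAdmissibleFrame n,
    KPTau.integrable_partitionIntegrand hu' n, ?_, fun t ht => ?_⟩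
  · rw [hZu]
    exact mul_ne_zero hn (Finset.prod_ne_zero_iff.mpr fun j _ => hp.h_ne_zero j)
  have hut := KPTau.contourIntegrable_cexp_eval hΓ ht
  have hratio : KPTau.partitionFunction n (u + t) ϰ Γ / KPTau.partitionFunction n u ϰ Γ =
      (KPTau.hankel (KPTau.momentFunctional (u + t) ϰ Γ) n).det /
        ∏ j ∈ Finset.range n, h j := by
    rw [hZu, KPTau.partitionFunction_eq_det_hankel hut, mul_div_mul_left _ _ hn]
  obtain ⟨K, hK, hKint, hfin, hrank, hdet⟩ := KPTau.exists_integral_operator hu' hut n ϰ H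
  refine ⟨KPTau.integrable_partitionIntegrand hut n, K, hKint, hfin, hrank, ?_, fun hstrong => ?_⟩
  · rw [hdet, hratio]
  have hL' : ∀ q : Polynomial ℂ, HasSum (fun l => KPTau.expCoeff d (-t) l *
      KPTau.momentLinear u ϰ Γ hu' (Polynomial.X ^ l * q))
      (KPTau.momentLinear (u + t) ϰ Γ hut q) :=
    KPTau.hasSum_expCoeff_mul_moment hΓ t ϰ hstrong
  refine ⟨?_, fun k => ⟨_, KPTau.X_pow_mem_hPlus hut n k⟩, fun k z => rfl, fun i k => ?_⟩
  · rw [hratio]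
    exact H.isKPTau hL' n
  have h1 := hasSum_sum (s := Finset.range n) fun a ha =>
    (H.hasSum_graphCoeff_mul_shiftCoeff hL' n a (n + k) (Finset.mem_range.mp ha)).mul_left
      (KPTau.shiftCoeff d t (n + i) a)
  -- The series for -G C⁻¹ sums to `mixedCoeff` minus an entry of e^{-ξ}. That entry sits at (a, n +
  -- k) with a < n, above the diagonal, so it is zero.
  have h2 : KPTau.taylorCoeff (K ⟨_, KPTau.X_pow_mem_hPlus hut n k⟩ : ℂ → ℂ) (n + i) =
      ∑ a ∈ Finset.range n, KPTau.shiftCoeff d t (n + i) a *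
        (KPTau.mixedCoeff (KPTau.momentLinear (u + t) ϰ Γ hut) p h n a (n + k) -
          KPTau.shiftCoeff d (-t) a (n + k)) := by
    have hflow : ∀ j, Differentiable ℂ (KPTau.flow d t fun z => (p j).eval z) := fun j =>
      KPTau.differentiable_flow (KPTau.differentiable_eval _)
    rw [hK, KPTau.taylorCoeff_sum _ fun j =>
      (KPTau.differentiable_tailPart n (hflow j)).const_mul _]
    have h3 : ∀ j ∈ Finset.range n, ∀ c : ℂ, KPTau.taylorCoeff (fun z => c *
        KPTau.tailPart n (KPTau.flow d t fun x => (p j).eval x) z) (n + i) =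
        ∑ a ∈ Finset.range n, c * (KPTau.shiftCoeff d t (n + i) a * (p j).coeff a) := by
      intro j hj c
      rw [KPTau.taylorCoeff_const_mul (KPTau.differentiable_tailPart n (hflow j)),
        KPTau.taylorCoeff_tailPart n (hflow j), if_neg (by omega),
        KPTau.taylorCoeff_flow_eval_of_degree_lt d t (H.degree_lt (Finset.mem_range.mp hj)),
        Finset.mul_sum]
    rw [Finset.sum_congr rfl fun j hj => h3 j hj _, Finset.sum_comm]
    refine Finset.sum_congr rfl fun a ha => ?_
    rw [KPTau.shiftCoeff_of_lt d (-t) (i := a) (j := n + k)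
      (by have := Finset.mem_range.mp ha; omega), sub_zero, KPTau.mixedCoeff, Finset.mul_sum]
    refine Finset.sum_congr rfl fun j _ => ?_
    have h4 : KPTau.weightedIntegral n (u + t) ϰ Γ (p j) ⟨_, KPTau.X_pow_mem_hPlus hut n k⟩ =
        KPTau.momentLinear (u + t) ϰ Γ hut (Polynomial.X ^ (n + k) * p j) := by
      simp only [KPTau.weightedIntegral, KPTau.momentLinear, KPTau.momentFunctional,
        LinearMap.coe_mk, AddHom.coe_mk, Polynomial.eval_mul, Polynomial.eval_pow,
        Polynomial.eval_X]
      congr 1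
      funext x
      ring
    rw [h4]
    ring
  rw [h2]
  refine KPTau.hasSum_of_forall_eq h1 fun l => ?_
  rw [← Finset.sum_neg_distrib]
  refine Finset.sum_congr rfl fun a ha => ?_
  rw [KPTau.flowMatrix_apply, KPTau.graphMatrix_eq H n a l (Finset.mem_range.mp ha),
    KPTau.triInv_plusBlock_flowMatrix, KPTau.shiftCoeff_add]
  ring
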